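/- Let $\widehat{\mathcal A}$ be the $\mathbb C$-algebra of formal power series $X=\sum_{p,q\ge 0}x_{p,q}\,a^pb^q$ ($x_{p,q}\in\mathbb C$) in two variables $a,b$ subject to the commutation relation $ab-ba=b^2$ (multiplication being continuous for the $(a,b)$-adic topology), so that $$b^qa^p=\sum_{j=0}^{p}(-1)^j\,\Gamma^j_{p,q}\,a^{p-j}b^{q+j},\qquad \Gamma^j_{p,q}=\frac{(q+j-1)!}{j!\,(q-1)!}\,\frac{p!}{(p-j)!}\quad(q\ge 1).$$ Let $\tilde{\mathcal A}_{conv}\subset\widehat{\mathcal A}$ be the subalgebra of those $X=\sum x_{p,q}a^pb^q$ for which there exist $R>1$ and $C$ with $|x_{p,q}|\le C\,R^{p+q}\,q!$ for all $p,q\ge 0$. A left ideal $I$ of $\tilde{\mathcal A}_{conv}$ is called normal if, for every $x\in\tilde{\mathcal A}_{conv}$, $bx\in I$ implies $x\in I$; a right ideal $I$ is called normal if, for every $x\in\tilde{\mathcal A}_{conv}$, $xb\in I$ implies $x\in I$. Then $\tilde{\mathcal A}_{conv}$ is left noetherian and right noetherian. Moreover, every normal left ideal of $\tilde{\mathcal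 A}_{conv}$ is of the form $\tilde{\mathcal A}_{conv}\,x$, and every normal right ideal is of the form $x\,\tilde{\mathcal A}_{conv}$, for some $x\in\tilde{\mathcal A}_{conv}$. -/

import Mathlib

/-- Formal power series `∑ x_{p,q} a^p b^q` in two variables `a`, `b` (with `a` written to the
left of `b`), recorded by the coefficients `coeff p q = x_{p,q}`. The multiplication below is the
one determined by the commutation relation `a b - b a = b^2` and by continuity for the
`(a,b)`-adic valuation. -/
@[ext]
structure FormalAB where
  /-- the coefficient of `a^p b^q` -/
  coeff : ℕ → ℕ → ℂ

namespace FormalAB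

open Finset

/-- `Γ_{p,q}^j = (q+j-1)! / (j! (q-1)!) * p! / (p-j)!` (for `q = 0` it is `1` if `j = 0` and `0`
otherwise, and it vanishes for `j > p`), so that
`a^p b^q = ∑_j Γ_{p,q}^j b^(q+j) a^(p-j)` and `b^q a^p = ∑_j (-1)^j Γ_{p,q}^j a^(p-j) b^(q+j)`. -/
def Gam (p q j : ℕ) : ℕ := q.multichoose j * p.descFactorial j

instance : Zero FormalAB := ⟨⟨fun _ _ => 0⟩⟩
instance : One FormalAB := ⟨⟨fun p q => if p = 0 ∧ q = 0 then 1 else 0⟩⟩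
instance : Add FormalAB := ⟨fun X Y => ⟨fun p q => X.coeff p q + Y.coeff p q⟩⟩
instance : Neg FormalAB := ⟨fun X => ⟨fun p q => -X.coeff p q⟩⟩
instance : SMul ℂ FormalAB := ⟨fun c X => ⟨fun p q => c * X.coeff p q⟩⟩

/-- The product: since `b^q a^p' = ∑_j (-1)^j Γ_{p',q}^j a^(p'-j) b^(q+j)`, the coefficient of
`a^m b^n` in `X Y` is the sum of `(-1)^j Γ_{p',q}^j x_{p,q} y_{p',q'}` over `p + (p' - j) = m` and
`(q + j) + q' = n`. Here `u = (p, p' - j)`, `v = (q + j, q')` and `w = (q, j)`. -/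
instance : Mul FormalAB := ⟨fun X Y => ⟨fun m n =>
  ∑ u ∈ antidiagonal m, ∑ v ∈ antidiagonal n, ∑ w ∈ antidiagonal v.1,
    (-1 : ℂ) ^ w.2 * (Gam (u.2 + w.2) w.1 w.2 : ℂ)
      * (X.coeff u.1 w.1 * Y.coeff (u.2 + w.2) v.2)⟩⟩

@[simp] theorem coeff_zero (p q : ℕ) : (0 : FormalAB).coeff p q = 0 := rfl
theorem coeff_one (p q : ℕ) :
    (1 : FormalAB).coeff p q = if p = 0 ∧ q = 0 then 1 else 0 := rfl
@[simp] theorem coeff_add (X Y : FormalAB) (p q : ℕ) :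
    (X + Y).coeff p q = X.coeff p q + Y.coeff p q := rfl
@[simp] theorem coeff_neg (X : FormalAB) (p q : ℕ) : (-X).coeff p q = -X.coeff p q := rfl
@[simp] theorem coeff_smul (c : ℂ) (X : FormalAB) (p q : ℕ) :
    (c • X).coeff p q = c * X.coeff p q := rfl
theorem coeff_mul (X Y : FormalAB) (m n : ℕ) : (X * Y).coeff m n =
    ∑ u ∈ antidiagonal m, ∑ v ∈ antidiagonal n, ∑ w ∈ antidiagonal v.1,
      (-1 : ℂ) ^ w.2 * (Gam (u.2 + w.2) w.1 w.2 : ℂ)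
        * (X.coeff u.1 w.1 * Y.coeff (u.2 + w.2) v.2) := rfl

/-! ### Associativity, through the action `a^p b^q (z^r) = r! / (q+r)! z^(p+q+r)` -/

/-- The coefficient of `z^(r+d)` in the action of `X` on `z^r`. -/
noncomputable def act (X : FormalAB) (d r : ℕ) : ℂ :=
  ∑ s ∈ antidiagonal d, X.coeff s.1 s.2 * ((r.factorial : ℂ) / ((r + s.2).factorial : ℂ))

theorem Gam_zero_right (p q : ℕ) : Gam p q 0 = 1 := by simp [Gam]

theorem succ_mul_multichoose (q j : ℕ) :
    (j + 1) * q.multichoose (j + 1) = q * (q + 1).multichoose j := by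
  rcases q with _ | q
  · simp
  · rw [Nat.multichoose_eq, Nat.multichoose_eq]
    have h := Nat.add_one_mul_choose_eq (q + j) j
    have h2 := Nat.choose_succ_right_eq (q + j + 1) j
    have e1 : q + 1 + (j + 1) - 1 = q + j + 1 := by omega
    have e2 : q + 1 + 1 + j - 1 = q + j + 1 := by omega
    have e3 : q + j + 1 - j = q + 1 := by omega
    rw [e1, e2]
    rw [e3] at h2
    linarith

theorem succ_descFactorial_succ' (p j : ℕ) :
    (p + 1).descFactorial (j + 1) = p.descFactorial (j + 1) + (j + 1) * p.descFactorial j := by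
  rw [Nat.succ_descFactorial_succ, Nat.descFactorial_succ]
  rcases le_or_gt j p with h | h
  · rw [← add_mul]; congr 1; omega
  · simp [Nat.descFactorial_eq_zero_iff_lt.2 h]

theorem Gam_succ (p q j : ℕ) :
    Gam (p + 1) q (j + 1) = Gam p q (j + 1) + q * Gam p (q + 1) j := by
  unfold Gam
  rw [succ_descFactorial_succ', mul_add, ← mul_assoc q, ← succ_mul_multichoose]
  ring

theorem Gam_eq_zero {p q j : ℕ} (h : p < j) : Gam p q j = 0 := by
  simp [Gam, Nat.descFactorial_eq_zero_iff_lt.2 h]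

theorem monomial_identity (p q r : ℕ) :
    ((r + p).factorial : ℂ) / ((r + p + q).factorial : ℂ) =
      ∑ j ∈ range (p + 1), (-1 : ℂ) ^ j * (Gam p q j : ℂ) *
        ((r.factorial : ℂ) / ((r + q + j).factorial : ℂ)) := by
  induction p generalizing q with
  | zero => simp [Gam_zero_right]
  | succ p ih =>
    have h1 : ((r + (p + 1)).factorial : ℂ) / ((r + (p + 1) + q).factorial : ℂ) =
        ((r + p).factorial : ℂ) / ((r + p + q).factorial : ℂ) -
        q * (((r + p).factorial : ℂ) / ((r + p + (q + 1)).factorial : ℂ)) := by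
      have e1 : r + (p + 1) = (r + p) + 1 := by omega
      have e2 : r + p + 1 + q = (r + p + q) + 1 := by omega
      have e3 : r + p + (q + 1) = (r + p + q) + 1 := by omega
      rw [e1, e2, e3, Nat.factorial_succ, Nat.factorial_succ]
      have n1 : ((r + p + q).factorial : ℂ) ≠ 0 := by exact_mod_cast Nat.factorial_ne_zero _
      have n2 : ((r : ℂ) + p + q + 1) ≠ 0 := by exact_mod_cast Nat.succ_ne_zero (r + p + q)
      push_cast
      field_simp
      ring
    rw [h1, ih q, ih (q + 1)]
    have h2 : ∑ j ∈ range (p + 1), (-1 : ℂ) ^ j * (Gam p q j : ℂ) *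
        ((r.factorial : ℂ) / ((r + q + j).factorial : ℂ)) =
        ∑ j ∈ range (p + 1 + 1), (-1 : ℂ) ^ j * (Gam p q j : ℂ) *
        ((r.factorial : ℂ) / ((r + q + j).factorial : ℂ)) := by
      rw [sum_range_succ _ (p + 1), Gam_eq_zero (Nat.lt_succ_self p)]; simp
    rw [h2, sum_range_succ', sum_range_succ' _ (p + 1), mul_sum, Gam_zero_right, Gam_zero_right,
      add_sub_right_comm, ← sum_sub_distrib]
    congr 1
    refine sum_congr rfl fun j _ => ?_
    rw [Gam_succ, show r + (q + 1) + j = r + q + (j + 1) by omega]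
    push_cast
    ring

theorem act_mul (X Y : FormalAB) (N r : ℕ) :
    act (X * Y) N r = ∑ s ∈ antidiagonal N, act X s.1 (r + s.2) * act Y s.2 r := by
  have key : ∀ p q p' q' : ℕ,
      (X.coeff p q * (((r + (p' + q')).factorial : ℂ) / ((r + (p' + q') + q).factorial : ℂ))) *
      (Y.coeff p' q' * ((r.factorial : ℂ) / ((r + q').factorial : ℂ))) =
      ∑ j ∈ range (p' + 1), (-1 : ℂ) ^ j * (Gam p' q j : ℂ) * (X.coeff p q * Y.coeff p' q') *
        ((r.factorial : ℂ) / ((r + (q + j + q')).factorial : ℂ)) := by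
    intro p q p' q'
    have h := monomial_identity p' q (r + q')
    rw [show r + (p' + q') = r + q' + p' by omega, h, mul_sum, sum_mul]
    refine sum_congr rfl fun j _ => ?_
    have n1 : ((r + q').factorial : ℂ) ≠ 0 := by exact_mod_cast Nat.factorial_ne_zero _
    have n2 : ((r + q' + q + j).factorial : ℂ) ≠ 0 := by exact_mod_cast Nat.factorial_ne_zero _
    rw [show r + (q + j + q') = r + q' + q + j by omega]
    field_simp
  simp only [act, coeff_mul, sum_mul, mul_sum]
  have key2 : ∀ s ∈ antidiagonal N, ∀ x ∈ antidiagonal s.1, ∀ y ∈ antidiagonal s.2,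
      X.coeff x.1 x.2 * (((r + s.2).factorial : ℂ) / ((r + s.2 + x.2).factorial : ℂ)) *
      (Y.coeff y.1 y.2 * ((r.factorial : ℂ) / ((r + y.2).factorial : ℂ))) =
      ∑ k ∈ antidiagonal y.1, (-1 : ℂ) ^ k.2 * (Gam y.1 x.2 k.2 : ℂ) *
        (X.coeff x.1 x.2 * Y.coeff y.1 y.2) *
        ((r.factorial : ℂ) / ((r + (x.2 + k.2 + y.2)).factorial : ℂ)) := by
    intro s _ x _ y hy
    rw [← HasAntidiagonal.mem_antidiagonal.1 hy, key, ← Nat.sum_antidiagonal_swap,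
      Nat.sum_antidiagonal_eq_sum_range_succ_mk]
    rfl
  rw [sum_congr rfl fun s hs => sum_congr rfl fun y hy => sum_congr rfl fun x hx =>
    key2 s hs x hx y hy]
  simp only [sum_sigma']
  refine sum_nbij'
    (i := fun x => ⟨(x.2.1.1 + x.2.2.2.1, x.2.1.2 + x.2.2.2.2 + x.2.2.1.2),
      ⟨(x.2.1.2 + x.2.2.2.2, x.2.2.1.2), ⟨(x.2.1.1, x.2.2.2.1), (x.2.1.2, x.2.2.2.2)⟩⟩⟩)
    (j := fun x => ⟨(x.2.2.1.1 + x.2.2.2.1, x.2.2.1.2 + x.2.2.2.2 + x.2.1.2),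
      ⟨(x.2.2.1.1, x.2.2.2.1), ⟨(x.2.2.1.2 + x.2.2.2.2, x.2.1.2), (x.2.2.1.2, x.2.2.2.2)⟩⟩⟩)
      ?_ ?_ ?_ ?_ ?_
  · rintro ⟨⟨m, n⟩, ⟨p, i⟩, ⟨t, q'⟩, ⟨q, j⟩⟩ h
    simp only [mem_sigma, HasAntidiagonal.mem_antidiagonal] at h ⊢
    simp only [and_true]
    omega
  · rintro ⟨⟨m, n⟩, ⟨t, q'⟩, ⟨p, q⟩, ⟨i, j⟩⟩ h
    simp only [mem_sigma, HasAntidiagonal.mem_antidiagonal] at h ⊢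
    simp only [and_true]
    omega
  · rintro ⟨⟨m, n⟩, ⟨p, i⟩, ⟨t, q'⟩, ⟨q, j⟩⟩ h
    simp only [mem_sigma, HasAntidiagonal.mem_antidiagonal] at h ⊢
    obtain ⟨-, rfl, rfl, rfl⟩ := h
    rfl
  · rintro ⟨⟨m, n⟩, ⟨t, q'⟩, ⟨p, q⟩, ⟨i, j⟩⟩ h
    simp only [mem_sigma, HasAntidiagonal.mem_antidiagonal] at h ⊢
    obtain ⟨-, rfl, rfl, rfl⟩ := h
    rfl
  · rintro ⟨⟨m, n⟩, ⟨p, i⟩, ⟨t, q'⟩, ⟨q, j⟩⟩ h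
    simp only [mem_sigma, HasAntidiagonal.mem_antidiagonal] at h ⊢
    obtain ⟨-, rfl, rfl, rfl⟩ := h
    rfl

theorem coeff_eq_zero_of_sum (d : ℕ) : ∀ (c : ℕ → ℂ) (r₀ : ℕ),
    (∀ r ≥ r₀, ∑ q ∈ range (d + 1), c q * ((r.factorial : ℂ) / ((r + q).factorial : ℂ)) = 0) →
    ∀ q ≤ d, c q = 0 := by
  have nz : ∀ n : ℕ, (n.factorial : ℂ) ≠ 0 := fun n => by exact_mod_cast Nat.factorial_ne_zero n
  have lim : ∀ q : ℕ, Filter.Tendsto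
      (fun r : ℕ => (r.factorial : ℂ) / ((r + (q + 1)).factorial : ℂ)) Filter.atTop (nhds 0) := by
    intro q
    rw [tendsto_zero_iff_norm_tendsto_zero]
    refine squeeze_zero (fun _ => norm_nonneg _) (fun r => ?_) tendsto_one_div_add_atTop_nhds_zero_nat
    rw [norm_div, Complex.norm_natCast, Complex.norm_natCast,
      div_le_div_iff₀ (by exact_mod_cast Nat.factorial_pos _) (by positivity)]
    have h : (r + 1) * r.factorial ≤ (r + (q + 1)).factorial := by
      rw [← Nat.factorial_succ]
      exact Nat.factorial_le (by omega)
    have h' : ((r : ℝ) + 1) * r.factorial ≤ ((r + (q + 1)).factorial : ℝ) := by exact_mod_cast h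
    linarith
  have zero : ∀ (d : ℕ) (c : ℕ → ℂ) (r₀ : ℕ),
      (∀ r ≥ r₀, ∑ q ∈ range (d + 1), c q * ((r.factorial : ℂ) / ((r + q).factorial : ℂ)) = 0) →
      c 0 = 0 := by
    intro d c r₀ h
    have t : Filter.Tendsto (fun r : ℕ =>
        ∑ q ∈ range (d + 1), c q * ((r.factorial : ℂ) / ((r + q).factorial : ℂ)))
        Filter.atTop (nhds (c 0)) := by
      have t1 : Filter.Tendsto (fun r : ℕ => ∑ q ∈ range d,
          c (q + 1) * ((r.factorial : ℂ) / ((r + (q + 1)).factorial : ℂ)) + c 0)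
          Filter.atTop (nhds (∑ q ∈ range d, c (q + 1) * 0 + c 0)) :=
        (tendsto_finsetSum _ fun q _ => (lim q).const_mul _).add_const _
      simpa [sum_range_succ', nz] using t1
    refine tendsto_nhds_unique t (tendsto_const_nhds.congr' ?_)
    filter_upwards [Filter.eventually_ge_atTop r₀] with r hr
    exact (h r hr).symm
  induction d with
  | zero =>
    intro c r₀ h q hq
    obtain rfl : q = 0 := by omega
    exact zero 0 c r₀ h
  | succ d ih =>
    intro c r₀ h q hq
    have h0 := zero _ c r₀ h
    rcases q with _ | q
    · exact h0
    · refine ih (fun q => c (q + 1)) (r₀ + 1) (fun r hr => ?_) q (by omega)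
      obtain ⟨s, rfl⟩ : ∃ s, r = s + 1 := ⟨r - 1, by omega⟩
      have h1 := h s (by omega)
      rw [sum_range_succ', h0, zero_mul, add_zero] at h1
      have h2 : ∀ q, c (q + 1) * (((s + 1).factorial : ℂ) / ((s + 1 + q).factorial : ℂ)) =
          (s + 1) * (c (q + 1) * ((s.factorial : ℂ) / ((s + (q + 1)).factorial : ℂ))) := by
        intro q
        rw [show s + 1 + q = s + (q + 1) by omega, Nat.factorial_succ s]
        push_cast
        ring
      simp only [h2]
      rw [← mul_sum, h1, mul_zero]

theorem act_injective {X Y : FormalAB} (h : ∀ d r, act X d r = act Y d r) : X = Y := by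
  ext p q
  have h1 := coeff_eq_zero_of_sum (p + q)
    (fun k => X.coeff (p + q - k) k - Y.coeff (p + q - k) k) 0 (fun r _ => by
      have h2 := h (p + q) r
      simp only [act] at h2
      rw [← Nat.sum_antidiagonal_swap, ← Nat.sum_antidiagonal_swap (f := fun s =>
        Y.coeff s.1 s.2 * _), Nat.sum_antidiagonal_eq_sum_range_succ_mk,
        Nat.sum_antidiagonal_eq_sum_range_succ_mk] at h2
      simp only [Prod.fst_swap, Prod.snd_swap] at h2
      simp only [sub_mul, sum_sub_distrib]
      exact sub_eq_zero.2 h2) q (by omega)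
  simpa [sub_eq_zero] using h1

theorem act_one (d r : ℕ) : act 1 d r = if d = 0 then 1 else 0 := by
  have n1 : (r.factorial : ℂ) ≠ 0 := by exact_mod_cast Nat.factorial_ne_zero _
  rcases d with _ | d
  · simp [act, coeff_one, n1]
  · rw [if_neg (Nat.succ_ne_zero d)]
    refine sum_eq_zero fun s hs => ?_
    have := HasAntidiagonal.mem_antidiagonal.1 hs
    rw [coeff_one, if_neg (by omega), zero_mul]

instance : Ring FormalAB where
  add_assoc X Y Z := by ext; simp [add_assoc]
  zero_add X := by ext; simp
  add_zero X := by ext; simp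
  add_comm X Y := by ext; simp [add_comm]
  neg_add_cancel X := by ext; simp
  nsmul := nsmulRec
  zsmul := zsmulRec
  left_distrib X Y Z := by
    ext; simp only [coeff_mul, coeff_add, mul_add, sum_add_distrib]
  right_distrib X Y Z := by
    ext; simp only [coeff_mul, coeff_add, mul_add, add_mul, sum_add_distrib]
  zero_mul X := by ext; simp [coeff_mul]
  mul_zero X := by ext; simp [coeff_mul]
  one_mul X := by
    refine act_injective fun d r => ?_
    rw [act_mul, sum_eq_single (0, d)]
    · simp [act_one]
    · rintro ⟨i, j⟩ h1 h2
      have := HasAntidiagonal.mem_antidiagonal.1 h1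
      have h3 : i ≠ 0 := by rintro rfl; simp_all
      simp [act_one, h3]
    · simp
  mul_one X := by
    refine act_injective fun d r => ?_
    rw [act_mul, sum_eq_single (d, 0)]
    · simp [act_one]
    · rintro ⟨i, j⟩ h1 h2
      have := HasAntidiagonal.mem_antidiagonal.1 h1
      have h3 : j ≠ 0 := by rintro rfl; simp_all
      simp [act_one, h3]
    · simp
  mul_assoc X Y Z := by
    refine act_injective fun d r => ?_
    simp only [act_mul, sum_mul, mul_sum]
    simp only [sum_sigma']
    refine sum_nbij'
      (i := fun x => ⟨(x.2.1, x.2.2 + x.1.2), (x.2.2, x.1.2)⟩)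
      (j := fun x => ⟨(x.1.1 + x.2.1, x.2.2), (x.1.1, x.2.1)⟩) ?_ ?_ ?_ ?_ ?_
    · rintro ⟨⟨m, n⟩, ⟨k, l⟩⟩ h
      simp only [mem_sigma, HasAntidiagonal.mem_antidiagonal] at h ⊢
      simp only [and_true]
      omega
    · rintro ⟨⟨m, n⟩, ⟨k, l⟩⟩ h
      simp only [mem_sigma, HasAntidiagonal.mem_antidiagonal] at h ⊢
      simp only [and_true]
      omega
    · rintro ⟨⟨m, n⟩, ⟨k, l⟩⟩ h
      simp only [mem_sigma, HasAntidiagonal.mem_antidiagonal] at h ⊢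
      obtain ⟨-, rfl⟩ := h
      rfl
    · rintro ⟨⟨m, n⟩, ⟨k, l⟩⟩ h
      simp only [mem_sigma, HasAntidiagonal.mem_antidiagonal] at h ⊢
      obtain ⟨-, rfl⟩ := h
      rfl
    · rintro ⟨⟨m, n⟩, ⟨k, l⟩⟩ h
      rw [mul_assoc, show r + n + l = r + (l + n) by omega]

instance : Module ℂ FormalAB where
  one_smul X := by ext; simp
  mul_smul c d X := by ext; simp [mul_assoc]
  smul_zero c := by ext; simp
  smul_add c X Y := by ext; simp [mul_add]
  add_smul c d X := by ext; simp [add_mul]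
  zero_smul X := by ext; simp

instance : Algebra ℂ FormalAB := Algebra.ofModule
  (fun c X Y => by
    ext m n
    simp only [coeff_mul, coeff_smul, mul_sum]
    refine sum_congr rfl fun _ _ => sum_congr rfl fun _ _ => sum_congr rfl fun _ _ => ?_
    ring)
  (fun c X Y => by
    ext m n
    simp only [coeff_mul, coeff_smul, mul_sum]
    refine sum_congr rfl fun _ _ => sum_congr rfl fun _ _ => sum_congr rfl fun _ _ => ?_
    ring)

/-! ### The generators `a` and `b` -/

/-- The monomial `a^p b^q`. -/
def mono (p q : ℕ) : FormalAB := ⟨fun i j => if i = p ∧ j = q then 1 else 0⟩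

/-- The variable `a`. -/
def a : FormalAB := mono 1 0

/-- The variable `b`. -/
def b : FormalAB := mono 0 1

theorem act_mono (p q d r : ℕ) : act (mono p q) d r =
    if d = p + q then (r.factorial : ℂ) / ((r + q).factorial : ℂ) else 0 := by
  unfold act
  split_ifs with h
  · subst h
    rw [sum_eq_single (p, q)]
    · simp [mono]
    · rintro ⟨i, j⟩ _ h2
      have h3 : ¬ (i = p ∧ j = q) := by rintro ⟨rfl, rfl⟩; exact h2 rfl
      simp [mono, h3]
    · simp
  · refine sum_eq_zero fun s hs => ?_
    have h1 := HasAntidiagonal.mem_antidiagonal.1 hs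
    have h3 : ¬ (s.1 = p ∧ s.2 = q) := by omega
    simp [mono, h3]

theorem act_mono_mul_mono (p q p' q' d r : ℕ) : act (mono p q * mono p' q') d r =
    if d = p + q + (p' + q') then
      ((r + (p' + q')).factorial : ℂ) / ((r + (p' + q') + q).factorial : ℂ) *
        ((r.factorial : ℂ) / ((r + q').factorial : ℂ)) else 0 := by
  rw [act_mul]
  simp only [act_mono]
  split_ifs with h
  · subst h
    rw [sum_eq_single (p + q, p' + q')]
    · simp
    · rintro ⟨i, j⟩ h1 h2
      have h4 := HasAntidiagonal.mem_antidiagonal.1 h1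
      have h3 : ¬ (i = p + q) := by
        rintro rfl
        exact h2 (by simp only at h4; congr 1; omega)
      simp [h3]
    · simp
  · refine sum_eq_zero fun s hs => ?_
    have h1 := HasAntidiagonal.mem_antidiagonal.1 hs
    rcases eq_or_ne s.1 (p + q) with h3 | h3
    · rw [if_neg (c := s.2 = p' + q') (by omega), mul_zero]
    · rw [if_neg h3, zero_mul]

/-- The commutation relation `a b - b a = b^2`. -/
theorem a_mul_b_sub : a * b - b * a = b ^ 2 := by
  rw [sub_eq_iff_eq_add, sq]
  refine act_injective fun d r => ?_
  have hadd : ∀ X Y : FormalAB, act (X + Y) d r = act X d r + act Y d r := by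
    intro X Y
    simp [act, add_mul, sum_add_distrib]
  rw [hadd]
  unfold a b
  simp only [act_mono_mul_mono]
  split_ifs with h
  · have n1 : (r.factorial : ℂ) ≠ 0 := by exact_mod_cast Nat.factorial_ne_zero _
    have n2 : ((r : ℂ) + 1) ≠ 0 := by exact_mod_cast Nat.succ_ne_zero r
    have n3 : ((r : ℂ) + 1 + 1) ≠ 0 := by exact_mod_cast Nat.succ_ne_zero (r + 1)
    simp only [zero_add, add_zero, Nat.factorial_succ]
    push_cast
    field_simp
    ring
  all_goals simp

/-- `X.coeff p q` is the coefficient of `a^p b^q`. -/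
theorem a_pow_mul_b_pow (p q : ℕ) : a ^ p * b ^ q = mono p q := by
  have n1 : ∀ n : ℕ, (n.factorial : ℂ) ≠ 0 := fun n => by exact_mod_cast Nat.factorial_ne_zero _
  have ha : ∀ p, a ^ p = mono p 0 := by
    intro p
    induction p with
    | zero => rfl
    | succ p ih =>
      refine act_injective fun d r => ?_
      rw [pow_succ, ih, a, act_mono_mul_mono, act_mono]
      simp [n1]
  have hb : ∀ q, b ^ q = mono 0 q := by
    intro q
    induction q with
    | zero => rfl
    | succ q ih =>
      refine act_injective fun d r => ?_
      rw [pow_succ, ih, b, act_mono_mul_mono, act_mono,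
        show r + (0 + 1) + q = r + (q + 1) by omega]
      simp [n1]
  refine act_injective fun d r => ?_
  rw [ha, hb, act_mono_mul_mono, act_mono]
  simp [n1]

/-! ### The convergent subalgebra -/

/-- The growth condition `|x_{p,q}| ≤ C R^(p+q) q!` for some `R > 1` and some `C`. -/
def IsConv (X : FormalAB) : Prop :=
  ∃ R : ℝ, 1 < R ∧ ∃ C : ℝ, ∀ p q : ℕ, ‖X.coeff p q‖ ≤ C * R ^ (p + q) * (q.factorial : ℝ)

theorem IsConv.exists_ge {X : FormalAB} (h : IsConv X) :
    ∃ R₀ : ℝ, 1 < R₀ ∧ ∃ C₀ : ℝ, 0 ≤ C₀ ∧ ∀ R ≥ R₀, ∀ p q : ℕ,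
      ‖X.coeff p q‖ ≤ C₀ * R ^ (p + q) * (q.factorial : ℝ) := by
  obtain ⟨R, hR, C, h⟩ := h
  have hC : 0 ≤ C := by
    have := (norm_nonneg _).trans (h 0 0)
    simpa using this
  refine ⟨R, hR, C, hC, fun S hS p q => (h p q).trans ?_⟩
  have : 0 ≤ R := by linarith
  gcongr

theorem Gam_bound (i q j q' : ℕ) :
    Gam (i + j) q j * (q.factorial * q'.factorial) ≤
      2 ^ (i + j) * (q + j + q').factorial := by
  have h1 : (i + j).descFactorial j = j.factorial * (i + j).choose j :=
    Nat.descFactorial_eq_factorial_mul_choose _ _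
  have h2 : q.multichoose j ≤ (q + j).choose j := by
    rw [Nat.multichoose_eq]
    exact Nat.choose_le_choose _ (by omega)
  have h3 : (i + j).choose j ≤ 2 ^ (i + j) := Nat.choose_le_two_pow _ _
  have h4 : (q + j).choose j * j.factorial * q.factorial = (q + j).factorial := by
    have := Nat.add_choose_mul_factorial_mul_factorial q j
    linarith
  have h5 : (q + j).factorial * q'.factorial ≤ (q + j + q').factorial :=
    Nat.le_of_dvd (Nat.factorial_pos _) (Nat.factorial_mul_factorial_dvd_factorial_add _ _)
  calc Gam (i + j) q j * (q.factorial * q'.factorial)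
      = (i + j).choose j * ((q.multichoose j * j.factorial * q.factorial) * q'.factorial) := by
        rw [Gam, h1]; ring
    _ ≤ 2 ^ (i + j) * (((q + j).choose j * j.factorial * q.factorial) * q'.factorial) := by
        gcongr
    _ ≤ 2 ^ (i + j) * (q + j + q').factorial := by
        rw [h4]; gcongr

theorem IsConv.mul {X Y : FormalAB} (hX : IsConv X) (hY : IsConv Y) : IsConv (X * Y) := by
  obtain ⟨R₁, hR₁, C₁, hC₁, hX⟩ := hX.exists_ge
  obtain ⟨R₂, hR₂, C₂, hC₂, hY⟩ := hY.exists_ge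
  set R := max R₁ R₂
  have hR : 1 < R := lt_max_of_lt_left hR₁
  have hR0 : 0 ≤ R := by linarith
  have hX := hX R (le_max_left _ _)
  have hY := hY R (le_max_right _ _)
  refine ⟨8 * R, by linarith, C₁ * C₂, fun m n => ?_⟩
  rw [coeff_mul]
  set K : ℝ := C₁ * C₂ * (2 * R) ^ (m + n) * (n.factorial : ℝ) with hK
  have hK0 : 0 ≤ K := by positivity
  have term : ∀ u ∈ antidiagonal m, ∀ v ∈ antidiagonal n, ∀ w ∈ antidiagonal v.1,
      ‖(-1 : ℂ) ^ w.2 * (Gam (u.2 + w.2) w.1 w.2 : ℂ)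
        * (X.coeff u.1 w.1 * Y.coeff (u.2 + w.2) v.2)‖ ≤ K := by
    rintro ⟨p, i⟩ hu ⟨t, q'⟩ hv ⟨q, j⟩ hw
    have hu := HasAntidiagonal.mem_antidiagonal.1 hu
    have hv := HasAntidiagonal.mem_antidiagonal.1 hv
    have hw := HasAntidiagonal.mem_antidiagonal.1 hw
    simp only at hu hv hw ⊢
    subst hw hv hu
    rw [norm_mul, norm_mul, norm_mul, norm_pow, norm_neg, norm_one, one_pow, one_mul,
      Complex.norm_natCast]
    have hG : (Gam (i + j) q j : ℝ) * (q.factorial * q'.factorial) ≤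
        2 ^ (i + j) * (q + j + q').factorial := by exact_mod_cast Gam_bound i q j q'
    calc (Gam (i + j) q j : ℝ) * (‖X.coeff p q‖ * ‖Y.coeff (i + j) q'‖)
        ≤ (Gam (i + j) q j : ℝ) * ((C₁ * R ^ (p + q) * q.factorial) *
            (C₂ * R ^ (i + j + q') * q'.factorial)) := by
          have := hX p q
          have := hY (i + j) q'
          gcongr
      _ = C₁ * C₂ * R ^ (p + i + (q + j + q')) *
            ((Gam (i + j) q j : ℝ) * (q.factorial * q'.factorial)) := by ring
      _ ≤ C₁ * C₂ * R ^ (p + i + (q + j + q')) * (2 ^ (i + j) * (q + j + q').factorial) := by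
          gcongr
      _ ≤ C₁ * C₂ * R ^ (p + i + (q + j + q')) *
            (2 ^ (p + i + (q + j + q')) * (q + j + q').factorial) := by
          gcongr
          · norm_num
          · omega
          · omega
      _ = K := by rw [hK, mul_pow]; ring
  have bound : ∀ n : ℕ, ((n : ℝ) + 1) ≤ 2 ^ n := fun n => by
    exact_mod_cast Nat.lt_two_pow_self (n := n)
  calc _ ≤ ∑ u ∈ antidiagonal m, ∑ v ∈ antidiagonal n, ∑ w ∈ antidiagonal v.1, K := by
        refine norm_sum_le_of_le _ fun u hu => norm_sum_le_of_le _ fun v hv =>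
          norm_sum_le_of_le _ fun w hw => term u hu v hv w hw
    _ ≤ ∑ u ∈ antidiagonal m, ∑ v ∈ antidiagonal n, 2 ^ n * K := by
        refine sum_le_sum fun u _ => sum_le_sum fun v hv => ?_
        have hv := HasAntidiagonal.mem_antidiagonal.1 hv
        rw [sum_const, Nat.card_antidiagonal, nsmul_eq_mul]
        push_cast
        refine mul_le_mul_of_nonneg_right ((bound _).trans ?_) hK0
        exact pow_le_pow_right₀ (by norm_num) (by omega)
    _ = ((m : ℝ) + 1) * (((n : ℝ) + 1) * (2 ^ n * K)) := by
        simp [sum_const, Nat.card_antidiagonal, nsmul_eq_mul]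
    _ ≤ 4 ^ m * (2 ^ n * (2 ^ n * K)) := by
        have h1 := bound m
        have h2 := bound n
        have h3 : (2 : ℝ) ^ m ≤ 4 ^ m := by gcongr; norm_num
        have h4 : (m : ℝ) + 1 ≤ 4 ^ m := h1.trans h3
        gcongr
    _ = C₁ * C₂ * (8 * R) ^ (m + n) * (n.factorial : ℝ) := by
        rw [hK, show (8 * R) = 4 * (2 * R) by ring, mul_pow 4, pow_add 4,
          show (4 : ℝ) ^ n = 2 ^ n * 2 ^ n by rw [← mul_pow]; norm_num]
        ring

theorem IsConv.add {X Y : FormalAB} (hX : IsConv X) (hY : IsConv Y) : IsConv (X + Y) := by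
  obtain ⟨R₁, hR₁, C₁, hC₁, hX⟩ := hX.exists_ge
  obtain ⟨R₂, hR₂, C₂, hC₂, hY⟩ := hY.exists_ge
  refine ⟨max R₁ R₂, lt_max_of_lt_left hR₁, C₁ + C₂, fun p q => ?_⟩
  have h1 := hX _ (le_max_left R₁ R₂) p q
  have h2 := hY _ (le_max_right R₁ R₂) p q
  rw [coeff_add, add_mul, add_mul]
  exact (norm_add_le _ _).trans (add_le_add h1 h2)

theorem isConv_mono (p q : ℕ) : IsConv (mono p q) := by
  refine ⟨2, by norm_num, 1, fun i j => ?_⟩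
  have h1 : (1 : ℝ) ≤ 2 ^ (i + j) := one_le_pow₀ (by norm_num)
  have h2 : (1 : ℝ) ≤ (j.factorial : ℝ) := by exact_mod_cast Nat.factorial_pos j
  have h3 : ‖(mono p q).coeff i j‖ ≤ 1 := by
    unfold mono
    dsimp only
    split_ifs <;> simp
  rw [one_mul]
  exact h3.trans (one_le_mul_of_one_le_of_one_le h1 h2)

theorem IsConv.smul (c : ℂ) {X : FormalAB} (hX : IsConv X) : IsConv (c • X) := by
  obtain ⟨R, hR, C, h⟩ := hX
  refine ⟨R, hR, ‖c‖ * C, fun p q => ?_⟩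
  rw [coeff_smul, norm_mul, mul_assoc, mul_assoc, ← mul_assoc C]
  exact mul_le_mul_of_nonneg_left (h p q) (norm_nonneg c)

end FormalAB

/-- The algebra `Ã_conv`: the formal power series `∑ x_{p,q} a^p b^q` with
`|x_{p,q}| ≤ C R^(p+q) q!` for some `R > 1` and some `C`. -/
def AConv : Subalgebra ℂ FormalAB where
  carrier := {X | X.IsConv}
  mul_mem' hX hY := hX.mul hY
  add_mem' hX hY := hX.add hY
  algebraMap_mem' c := by
    change FormalAB.IsConv (algebraMap ℂ FormalAB c)
    rw [Algebra.algebraMap_eq_smul_one]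
    exact (FormalAB.isConv_mono 0 0).smul c

namespace AConv

/-- The element `a` of `Ã_conv`. -/
def a : AConv := ⟨FormalAB.a, FormalAB.isConv_mono 1 0⟩

/-- The element `b` of `Ã_conv`. -/
def b : AConv := ⟨FormalAB.b, FormalAB.isConv_mono 0 1⟩

/-- A left ideal `I` is normal if `b x ∈ I` implies `x ∈ I`. -/
def IsNormalLeft (I : Submodule AConv AConv) : Prop := ∀ x : AConv, b * x ∈ I → x ∈ I

/-- A right ideal `I` is normal if `x b ∈ I` implies `x ∈ I`. -/
def IsNormalRight (I : Submodule (AConv)ᵐᵒᵖ AConv) : Prop := ∀ x : AConv, x * b ∈ I → x ∈ I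

end AConv

/-! The argument is a Weierstrass-type division. Say that `x` has order `k` if `a^k` is the lowest
pure power of `a` occurring in `x`; an element without order is divisible by `b`. For `x` of order
`k`, every `y` is `x * s` plus a remainder in which only the powers `a^p` with `p < k` occur. If
this remainder is nonzero, removing the largest power `b^m` leaves an element of order less than
`k`.

Algebraic consequences (`HasDivision`). In a nonzero normal ideal, an element of least order
generates: the remainder lies in the ideal, so by normality it can be stripped of its power of `b`,
and a nonzero one would contradict minimality. For an arbitrary ideal `I`, the ideals `(I : b^n)`
increase to a normal ideal, which is principal, so its generator already lies in some `(I : b^N)`.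
Finite generation then descends from `(I : b^(n+1))` to `(I : b^n)` by adjoining at most one element
of least order (`fg_of_fg_colon`).

Analytic core (`FormalAB.exists_division`). After scaling `x` so that its leading coefficient is
`1`, write it as `a^k - U`; the quotient solves a fixed point equation for `Q ↦ shiftA k (U * Q)`.
The weights `l^(p+n) ∫_c^1 t^p (1-t)^n / n! dt` make this map a contraction. In the majorant, `a`
acts as multiplication by `t` and `b` as integration from `t` to `1`, so reordering `b^m a^p` loses
nothing and `b^m` has norm at most `l^m (1-c)^m / m!`, whereas dividing by `a^k` costs at most
`(2/l)^k`. A small `l` controls the terms `a^p` with `p > k`, and then `c` close to `1` controls all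
terms containing `b`.

Division is proved for right ideals only. The antiautomorphism fixing `a` and sending `b` to `-b`
preserves orders and convergence, and carries everything over to left ideals. -/

/-! ### Modules with a division algorithm -/

/-- An additive endomorphism `β` of a module which is semilinear in a weak sense, together with a
relation `Ord x k` (`x` has order `k`) such that elements without order are divisible by `β` and
such that division by an element of order `k` leaves a remainder which is zero or of the form
`β^m r'` with `r'` of order less than `k`. -/
structure HasDivision (S : Type*) {M : Type*} [Ring S] [AddCommGroup M] [Module S M]
    (β : M →+ M) (Ord : M → ℕ → Prop) : Prop where
  semilinear : ∀ s : S, ∃ s' : S, ∀ x, β (s • x) = s' • β x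
  exists_ord : ∀ x, (∃ k, Ord x k) ∨ ∃ x', x = β x'
  division : ∀ x y k, Ord x k → ∃ s : S, y = s • x ∨
    ∃ m r l, y - s • x = β^[m] r ∧ Ord r l ∧ l < k

namespace HasDivision

variable {S M : Type*} [Ring S] [AddCommGroup M] [Module S M] {β : M →+ M} {Ord : M → ℕ → Prop}

/-- The submodule of those `x` with `β x ∈ I`. -/
def colon (h : HasDivision S β Ord) (I : Submodule S M) : Submodule S M where
  carrier := {x | β x ∈ I}
  add_mem' hx hy := by
    simp only [Set.mem_ofPred_eq, map_add] at *
    exact I.add_mem hx hy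
  zero_mem' := by simp
  smul_mem' s x hx := by
    obtain ⟨s', hs⟩ := h.semilinear s
    simp only [Set.mem_ofPred_eq] at *
    rw [hs]
    exact I.smul_mem _ hx

theorem mem_colon (h : HasDivision S β Ord) {I : Submodule S M} {x : M} :
    x ∈ h.colon I ↔ β x ∈ I := Iff.rfl

theorem le_colon (h : HasDivision S β Ord) {I : Submodule S M}
    (hI : ∀ x ∈ I, β x ∈ I) : I ≤ h.colon I := hI

theorem iterate_mem {I : Submodule S M} (hI : ∀ x, β x ∈ I → x ∈ I) (m : ℕ) :
    ∀ x, β^[m] x ∈ I → x ∈ I := by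
  induction m with
  | zero => exact fun x hx => hx
  | succ m ih => exact fun x hx => hI x (ih _ hx)

theorem exists_min_ord (I : Submodule S M) (hI : ∃ x ∈ I, ∃ k, Ord x k) :
    ∃ x ∈ I, ∃ k, Ord x k ∧ ∀ r ∈ I, ∀ l, Ord r l → k ≤ l := by
  classical
  have hex : ∃ k, ∃ x ∈ I, Ord x k := by
    obtain ⟨x, hx, k, hk⟩ := hI
    exact ⟨k, x, hx, hk⟩
  obtain ⟨x, hx, hk⟩ := Nat.find_spec hex
  exact ⟨x, hx, _, hk, fun r hr l hl => Nat.find_min' hex ⟨r, hr, hl⟩⟩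

/-- If every nonzero element is of the form `β^m r` with `r` having an order, submodules saturated
with respect to `β` are principal. -/
theorem exists_eq_span_singleton (h : HasDivision S β Ord)
    (hsep : ∀ x, x ≠ 0 → ∃ m r k, x = β^[m] r ∧ Ord r k)
    (I : Submodule S M) (hI : ∀ x, β x ∈ I → x ∈ I) :
    ∃ x, I = Submodule.span S {x} := by
  by_cases h0 : I = ⊥
  · exact ⟨0, by simp [h0]⟩
  obtain ⟨z, hz, hz0⟩ := I.exists_mem_ne_zero_of_ne_bot h0
  obtain ⟨m, r, k, rfl, hr⟩ := hsep z hz0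
  -- Saturation puts `r` itself in `I`, so `I` contains an element with an order.
  obtain ⟨x, hx, k, hk, hmin⟩ := exists_min_ord I ⟨r, iterate_mem hI m r hz, k, hr⟩
  refine ⟨x, le_antisymm (fun y hy => ?_) ?_⟩
  · obtain ⟨s, hs | ⟨m, r, l, hs, hr, hl⟩⟩ := h.division x y k hk
    · rw [hs]
      exact Submodule.smul_mem _ _ (Submodule.mem_span_singleton_self x)
    · have hrI : r ∈ I := iterate_mem hI m r (hs ▸ I.sub_mem hy (I.smul_mem s hx))
      exact absurd (hmin r hrI l hr) (by omega)
  · rwa [Submodule.span_singleton_le_iff_mem]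

/-- Generators of `I` are the images under `β` of generators of the colon submodule, together with
one element of least order if some element of `I` has an order. Reducing by that element leaves a
remainder in `I` that is divisible by `β`, hence is the image of an element of the colon. -/
theorem fg_of_fg_colon (h : HasDivision S β Ord) (I : Submodule S M)
    (hI : (h.colon I).FG) : I.FG := by
  classical
  have hmap : ∀ (t : Set M) (x : M), x ∈ Submodule.span S t →
      β x ∈ Submodule.span S (β '' t) := by
    intro t x hx
    induction hx using Submodule.span_induction with
    | mem x hx => exact Submodule.subset_span ⟨x, hx, rfl⟩
    | zero => simp
    | add x y _ _ hx hy => rw [map_add]; exact Submodule.add_mem _ hx hy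
    | smul s x _ hx =>
      obtain ⟨s', hs⟩ := h.semilinear s
      rw [hs]
      exact Submodule.smul_mem _ _ hx
  obtain ⟨t, ht⟩ := hI
  have ht' : ∀ x ∈ t, β x ∈ I := fun x hx => h.mem_colon.1 (ht ▸ Submodule.subset_span hx)
  have hβ : ∀ x, β x ∈ I → β x ∈ Submodule.span S (β '' (t : Set M)) := fun x hx =>
    hmap _ x (ht ▸ h.mem_colon.2 hx)
  by_cases hord : ∃ x ∈ I, ∃ k, Ord x k
  · obtain ⟨x, hx, k, hk, hmin⟩ := exists_min_ord I hord
    refine ⟨insert x (t.image β), le_antisymm ?_ fun y hy => ?_⟩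
    · rw [Submodule.span_le]
      intro y hy
      simp only [Finset.coe_insert, Finset.coe_image, Set.mem_insert_iff, Set.mem_image] at hy
      obtain rfl | ⟨z, hz, rfl⟩ := hy
      · exact hx
      · exact ht' z hz
    · rw [Finset.coe_insert, Finset.coe_image]
      obtain ⟨s, hs⟩ := h.division x y k hk
      have hx' : s • x ∈ Submodule.span S (insert x (β '' (t : Set M))) :=
        Submodule.smul_mem _ _ (Submodule.subset_span (Set.mem_insert _ _))
      obtain hs | ⟨m, r, l, hs, hr, hl⟩ := hs
      · rwa [hs]
      · have hyI : y - s • x ∈ I := I.sub_mem hy (I.smul_mem s hx)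
        -- For `m = 0` the remainder would be an element of `I` of order below the minimum; for `m >
        -- 0` it is `β` of an element of the colon.
        rcases m with _ | m
        · rw [hs] at hyI
          exact absurd (hmin r hyI l hr) (by omega)
        · rw [Function.iterate_succ_apply'] at hs
          rw [hs] at hyI
          rw [sub_eq_iff_eq_add.1 hs]
          exact Submodule.add_mem _
            (Submodule.span_mono (Set.subset_insert _ _) (hβ _ hyI)) hx'
  · refine ⟨t.image β, le_antisymm ?_ fun y hy => ?_⟩
    · rw [Submodule.span_le]
      intro y hy
      simp only [Finset.coe_image, Set.mem_image] at hy
      obtain ⟨z, hz, rfl⟩ := hy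
      exact ht' z hz
    · rw [Finset.coe_image]
      obtain hk | ⟨z, rfl⟩ := h.exists_ord y
      · exact absurd ⟨y, hy, hk⟩ hord
      · exact hβ z hy

/-- The chain of iterated colons is increasing and its union is saturated, hence principal. The
chain is therefore constant from some `N` on, with `J N` principal, and finite generation is brought
back from `N` to `0` one colon at a time. -/
theorem isNoetherian (h : HasDivision S β Ord)
    (hsep : ∀ x, x ≠ 0 → ∃ m r k, x = β^[m] r ∧ Ord r k)
    (hstable : ∀ (I : Submodule S M), ∀ x ∈ I, β x ∈ I) : IsNoetherian S M := by
  refine ⟨fun I => ?_⟩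
  let J : ℕ → Submodule S M := fun n => h.colon^[n] I
  have hJsucc : ∀ n, J (n + 1) = h.colon (J n) := fun n => Function.iterate_succ_apply' _ _ _
  have hmono : Monotone J := monotone_nat_of_le_succ fun n => by
    rw [hJsucc]
    exact h.le_colon (hstable _)
  have hmem : ∀ x, x ∈ ⨆ n, J n ↔ ∃ n, x ∈ J n := fun x =>
    Submodule.mem_iSup_of_directed _ hmono.directed_le
  obtain ⟨x, hx⟩ := h.exists_eq_span_singleton hsep (⨆ n, J n) fun x hx => by
    obtain ⟨n, hn⟩ := (hmem _).1 hx
    exact (hmem x).2 ⟨n + 1, by rw [hJsucc]; exact h.mem_colon.2 hn⟩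
  obtain ⟨N, hN⟩ := (hmem x).1 (hx ▸ Submodule.mem_span_singleton_self x)
  have hfgN : (J N).FG := by
    have : J N = Submodule.span S {x} := le_antisymm (hx ▸ le_iSup J N)
      ((Submodule.span_singleton_le_iff_mem _ _).2 hN)
    rw [this]
    exact Submodule.fg_span_singleton x
  have hdesc : ∀ n, (J n).FG → I.FG := by
    intro n
    induction n with
    | zero => exact id
    | succ n ih => exact fun hn => ih (h.fg_of_fg_colon _ (hJsucc n ▸ hn))
  exact hdesc N hfgN

end HasDivision

namespace FormalAB

open Finset

/-! ### The antiautomorphism `a ↦ a`, `b ↦ -b` -/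

/-- This is `a^p b^q = ∑_j Γ_{p,q}^j b^(q+j) a^(p-j)` evaluated on `z^R`, cleared of denominators:
the reordering opposite to `monomial_identity`. -/
theorem sum_Gam_mul_factorial (p q R : ℕ) :
    (∑ j ∈ range (p + 1), Gam p q j * (R + p - j).factorial) * (R + q).factorial =
      (R + q + p).factorial * R.factorial := by
  induction p generalizing q R with
  | zero => simp [Gam_zero_right, mul_comm]
  | succ p ih =>
    have h1 := ih q (R + 1)
    have h2 := ih (q + 1) R
    have e : ∑ j ∈ range (p + 1 + 1), Gam (p + 1) q j * (R + (p + 1) - j).factorial =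
        ∑ j ∈ range (p + 1), Gam p q j * (R + 1 + p - j).factorial +
          q * ∑ j ∈ range (p + 1), Gam p (q + 1) j * (R + p - j).factorial := by
      have e1 : ∑ j ∈ range (p + 1), Gam p q j * (R + 1 + p - j).factorial =
          ∑ j ∈ range (p + 1 + 1), Gam p q j * (R + 1 + p - j).factorial := by
        rw [sum_range_succ _ (p + 1), Gam_eq_zero (Nat.lt_succ_self p)]; simp
      rw [e1, sum_range_succ', sum_range_succ' _ (p + 1), mul_sum, Gam_zero_right, Gam_zero_right,
        add_right_comm, ← sum_add_distrib]
      congr 1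
      · refine sum_congr rfl fun j _ => ?_
        rw [Gam_succ, show R + (p + 1) - (j + 1) = R + p - j by omega,
          show R + 1 + p - (j + 1) = R + p - j by omega]
        ring
      · rw [show R + (p + 1) - 0 = R + 1 + p - 0 by omega]
    rw [e]
    have f1 : (R + 1 + q).factorial = (R + q + 1) * (R + q).factorial := by
      rw [← Nat.factorial_succ]; congr 1; omega
    have f2 : (R + (q + 1)).factorial = (R + q + 1) * (R + q).factorial := by
      rw [← Nat.factorial_succ]; congr 1
    have f3 : R + 1 + q + p = R + q + (p + 1) := by omega
    have f4 : R + (q + 1) + p = R + q + (p + 1) := by omega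
    rw [f1, f3, Nat.factorial_succ R] at h1
    rw [f2, f4] at h2
    refine Nat.eq_of_mul_eq_mul_left (Nat.succ_pos (R + q)) ?_
    simp only [Nat.succ_eq_add_one]
    linear_combination h1 + q * h2

theorem sum_Gam_factorial_div (p q R e : ℕ) :
    ∑ j ∈ range (p + 1), (Gam p q j : ℂ) * (((R + p - j).factorial : ℂ) / (e.factorial : ℂ)) =
      ((R + q + p).factorial : ℂ) / (e.factorial : ℂ) *
        ((R.factorial : ℂ) / ((R + q).factorial : ℂ)) := by
  have n1 : ((R + q).factorial : ℂ) ≠ 0 := by exact_mod_cast Nat.factorial_ne_zero _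
  have h : (∑ j ∈ range (p + 1), (Gam p q j : ℂ) * ((R + p - j).factorial : ℂ)) *
      ((R + q).factorial : ℂ) = ((R + q + p).factorial : ℂ) * (R.factorial : ℂ) := by
    exact_mod_cast sum_Gam_mul_factorial p q R
  simp only [← mul_div_assoc]
  rw [← sum_div, eq_div_iff n1, div_mul_eq_mul_div, h]
  ring

/-- The coefficients of the action of `φ(X)`, see `act_flip`. -/
noncomputable def coact (X : FormalAB) (d r : ℕ) : ℂ :=
  ∑ s ∈ antidiagonal d, X.coeff s.1 s.2 *
    ((-1) ^ s.2 * (((r + s.1).factorial : ℂ) / ((r + d).factorial : ℂ)))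

/-- The antiautomorphism of the algebra of formal power series which fixes `a` and sends `b` to
`-b`. -/
def flip (X : FormalAB) : FormalAB := ⟨fun m n =>
  (-1) ^ n * ∑ w ∈ antidiagonal n, (Gam (m + w.2) w.1 w.2 : ℂ) * X.coeff (m + w.2) w.1⟩

theorem coeff_flip (X : FormalAB) (m n : ℕ) : (flip X).coeff m n =
    (-1) ^ n * ∑ w ∈ antidiagonal n, (Gam (m + w.2) w.1 w.2 : ℂ) * X.coeff (m + w.2) w.1 := rfl

/-- Reindexing `(m, n), (q, j)` with `q + j = n` as `(m + j, q), (m, j)`. -/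
theorem sum_antidiagonal_antidiagonal (d : ℕ) (f : ℕ → ℕ → ℕ → ℂ) :
    ∑ s ∈ antidiagonal d, ∑ w ∈ antidiagonal s.2, f s.1 w.1 w.2 =
      ∑ s ∈ antidiagonal d, ∑ w ∈ antidiagonal s.1, f w.1 s.2 w.2 := by
  simp only [sum_sigma']
  refine sum_nbij' (i := fun x => ⟨(x.1.1 + x.2.2, x.2.1), (x.1.1, x.2.2)⟩)
    (j := fun x => ⟨(x.2.1, x.1.2 + x.2.2), (x.1.2, x.2.2)⟩) ?_ ?_ ?_ ?_ ?_
  · rintro ⟨⟨m, n⟩, ⟨q, j⟩⟩ h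
    simp only [mem_sigma, HasAntidiagonal.mem_antidiagonal] at h ⊢
    simp only [and_true]
    omega
  · rintro ⟨⟨m, n⟩, ⟨q, j⟩⟩ h
    simp only [mem_sigma, HasAntidiagonal.mem_antidiagonal] at h ⊢
    simp only [and_true]
    omega
  · rintro ⟨⟨m, n⟩, ⟨q, j⟩⟩ h
    simp only [mem_sigma, HasAntidiagonal.mem_antidiagonal] at h ⊢
    obtain ⟨-, rfl⟩ := h
    rfl
  · rintro ⟨⟨m, n⟩, ⟨q, j⟩⟩ h
    simp only [mem_sigma, HasAntidiagonal.mem_antidiagonal] at h ⊢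
    obtain ⟨-, rfl⟩ := h
    rfl
  · rintro ⟨⟨m, n⟩, ⟨q, j⟩⟩ h
    rfl

/-- `coact` is the action of `∑ x_{p,q} (-b)^q a^p`, and `flip X` is that series with each `b^q a^p`
rewritten with `a` on the left; `monomial_identity` is this rewriting. -/
theorem act_flip (X : FormalAB) (d r : ℕ) : act (flip X) d r = coact X d r := by
  have h1 : act (flip X) d r = ∑ s ∈ antidiagonal d, ∑ w ∈ antidiagonal s.2,
      (-1) ^ (w.1 + w.2) * (Gam (s.1 + w.2) w.1 w.2 : ℂ) * X.coeff (s.1 + w.2) w.1 *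
        ((r.factorial : ℂ) / ((r + (w.1 + w.2)).factorial : ℂ)) := by
    refine sum_congr rfl fun s _ => ?_
    rw [coeff_flip, mul_sum, sum_mul]
    refine sum_congr rfl fun w hw => ?_
    rw [← HasAntidiagonal.mem_antidiagonal.1 hw]
    ring
  rw [h1, sum_antidiagonal_antidiagonal d fun m q j =>
      (-1) ^ (q + j) * (Gam (m + j) q j : ℂ) * X.coeff (m + j) q *
        ((r.factorial : ℂ) / ((r + (q + j)).factorial : ℂ))]
  refine sum_congr rfl fun s hs => ?_
  have hs := HasAntidiagonal.mem_antidiagonal.1 hs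
  rw [show r + d = r + s.1 + s.2 by omega, monomial_identity, mul_sum, mul_sum,
    ← Nat.sum_antidiagonal_swap, Nat.sum_antidiagonal_eq_sum_range_succ_mk]
  refine sum_congr rfl fun j hj => ?_
  have hj : s.1 - j + j = s.1 := by have := mem_range.1 hj; omega
  simp only [Prod.fst_swap, Prod.snd_swap]
  rw [hj, add_assoc r]
  ring

/-- The reordering in the other direction, through `sum_Gam_factorial_div`. With `act_flip` it makes
`flip` an involution. -/
theorem coact_flip (X : FormalAB) (d r : ℕ) : coact (flip X) d r = act X d r := by
  have h1 : coact (flip X) d r = ∑ s ∈ antidiagonal d, ∑ w ∈ antidiagonal s.2,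
      (Gam (s.1 + w.2) w.1 w.2 : ℂ) * X.coeff (s.1 + w.2) w.1 *
        (((r + s.1).factorial : ℂ) / ((r + d).factorial : ℂ)) := by
    refine sum_congr rfl fun s _ => ?_
    have hsq : ((-1 : ℂ) ^ s.2) * (-1) ^ s.2 = 1 := by
      rw [← mul_pow]; norm_num
    rw [coeff_flip, mul_comm ((-1 : ℂ) ^ s.2), mul_assoc, ← mul_assoc ((-1 : ℂ) ^ s.2), hsq,
      one_mul, sum_mul]
  rw [h1, sum_antidiagonal_antidiagonal d fun m q j =>
      (Gam (m + j) q j : ℂ) * X.coeff (m + j) q *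
        (((r + m).factorial : ℂ) / ((r + d).factorial : ℂ))]
  refine sum_congr rfl fun s hs => ?_
  have hs := HasAntidiagonal.mem_antidiagonal.1 hs
  have n1 : ((r + d).factorial : ℂ) ≠ 0 := by exact_mod_cast Nat.factorial_ne_zero _
  have h2 := sum_Gam_factorial_div s.1 s.2 r (r + d)
  rw [show r + s.2 + s.1 = r + d by omega, div_self n1, one_mul] at h2
  rw [← h2, mul_sum, ← Nat.sum_antidiagonal_swap, Nat.sum_antidiagonal_eq_sum_range_succ_mk]
  refine sum_congr rfl fun j hj => ?_
  have hj' := mem_range.1 hj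
  have hj : s.1 - j + j = s.1 := by omega
  simp only [Prod.fst_swap, Prod.snd_swap]
  rw [hj, show r + s.1 - j = r + (s.1 - j) by omega]
  ring

theorem flip_flip (X : FormalAB) : flip (flip X) = X :=
  act_injective fun d r => by rw [act_flip, coact_flip]

/-- Here the factor `X` acts first, on `z^r`, and `Y` second: the order is reversed compared with
`act_mul`, which is why `flip` is an antiautomorphism. -/
theorem coact_mul (X Y : FormalAB) (N r : ℕ) :
    coact (X * Y) N r = ∑ s ∈ antidiagonal N, coact Y s.2 (r + s.1) * coact X s.1 r := by
  have key : ∀ p q p' q' : ℕ,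
      (Y.coeff p' q' * ((-1) ^ q' * (((r + (p + q) + p').factorial : ℂ) /
        ((r + (p + q) + (p' + q')).factorial : ℂ)))) *
      (X.coeff p q * ((-1) ^ q * (((r + p).factorial : ℂ) / ((r + (p + q)).factorial : ℂ)))) =
      ∑ j ∈ range (p' + 1), (-1 : ℂ) ^ j * (Gam p' q j : ℂ) * (X.coeff p q * Y.coeff p' q') *
        ((-1) ^ (q + j + q') * (((r + p + p' - j).factorial : ℂ) /
          ((r + (p + q) + (p' + q')).factorial : ℂ))) := by
    intro p q p' q'
    have h := sum_Gam_factorial_div p' q (r + p) (r + (p + q) + (p' + q'))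
    have h3 : ∀ j, (-1 : ℂ) ^ j * (Gam p' q j : ℂ) * (X.coeff p q * Y.coeff p' q') *
        ((-1) ^ (q + j + q') * (((r + p + p' - j).factorial : ℂ) /
          ((r + (p + q) + (p' + q')).factorial : ℂ))) =
        (-1) ^ (q + q') * (X.coeff p q * Y.coeff p' q') * ((Gam p' q j : ℂ) *
        (((r + p + p' - j).factorial : ℂ) / ((r + (p + q) + (p' + q')).factorial : ℂ))) := by
      intro j
      have hsq : ((-1 : ℂ) ^ j) * (-1) ^ j = 1 := by
        rw [← mul_pow]; norm_num
      rw [pow_add, pow_add, pow_add]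
      linear_combination ((-1 : ℂ) ^ q * (-1) ^ q' * (X.coeff p q * Y.coeff p' q') *
        ((Gam p' q j : ℂ) * (((r + p + p' - j).factorial : ℂ) /
          ((r + (p + q) + (p' + q')).factorial : ℂ)))) * hsq
    simp only [h3]
    rw [← mul_sum, h, ← add_assoc r p q]
    ring
  simp only [coact, coeff_mul, sum_mul, mul_sum]
  have key2 : ∀ s ∈ antidiagonal N, ∀ x ∈ antidiagonal s.1, ∀ y ∈ antidiagonal s.2,
      (Y.coeff y.1 y.2 * ((-1) ^ y.2 * (((r + s.1 + y.1).factorial : ℂ) /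
        ((r + s.1 + s.2).factorial : ℂ)))) *
      (X.coeff x.1 x.2 * ((-1) ^ x.2 * (((r + x.1).factorial : ℂ) / ((r + s.1).factorial : ℂ)))) =
      ∑ k ∈ antidiagonal y.1, (-1 : ℂ) ^ k.2 * (Gam y.1 x.2 k.2 : ℂ) *
        (X.coeff x.1 x.2 * Y.coeff y.1 y.2) *
        ((-1) ^ (x.2 + k.2 + y.2) * (((r + (x.1 + k.1)).factorial : ℂ) /
          ((r + N).factorial : ℂ))) := by
    intro s hs x hx y hy
    have hN := HasAntidiagonal.mem_antidiagonal.1 hs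
    have hx := HasAntidiagonal.mem_antidiagonal.1 hx
    have hy := HasAntidiagonal.mem_antidiagonal.1 hy
    rw [← hN, ← hx, ← hy, key, ← Nat.sum_antidiagonal_swap,
      Nat.sum_antidiagonal_eq_sum_range_succ_mk]
    refine sum_congr rfl fun j hj => ?_
    have hj := mem_range.1 hj
    simp only [Prod.fst_swap, Prod.snd_swap]
    rw [show r + x.1 + y.1 - j = r + (x.1 + (y.1 - j)) by omega, ← add_assoc r (x.1 + x.2)]
  rw [sum_congr rfl fun s hs => sum_congr rfl fun x hx => sum_congr rfl fun y hy =>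
    key2 s hs x hx y hy]
  simp only [sum_sigma']
  -- The product is indexed by `(p, i), (t, q'), (q, j)` with `q + j = t`, the composite action by
  -- `(p, q), (i + j, q'), (i, j)`.
  refine sum_nbij'
    (i := fun x => ⟨(x.2.1.1 + x.2.2.2.1, x.2.1.2 + x.2.2.2.2 + x.2.2.1.2),
      ⟨(x.2.1.1, x.2.2.2.1), ⟨(x.2.1.2 + x.2.2.2.2, x.2.2.1.2), (x.2.1.2, x.2.2.2.2)⟩⟩⟩)
    (j := fun x => ⟨(x.2.1.1 + x.2.2.2.1, x.2.1.2 + x.2.2.2.2 + x.2.2.1.2),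
      ⟨(x.2.1.1, x.2.2.2.1), ⟨(x.2.1.2 + x.2.2.2.2, x.2.2.1.2), (x.2.1.2, x.2.2.2.2)⟩⟩⟩)
      ?_ ?_ ?_ ?_ ?_
  · rintro ⟨⟨m, n⟩, ⟨p, i⟩, ⟨t, q'⟩, ⟨q, j⟩⟩ h
    simp only [mem_sigma, HasAntidiagonal.mem_antidiagonal] at h ⊢
    simp only [and_true]
    omega
  · rintro ⟨⟨m, n⟩, ⟨p, q⟩, ⟨t, q'⟩, ⟨i, j⟩⟩ h
    simp only [mem_sigma, HasAntidiagonal.mem_antidiagonal] at h ⊢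
    simp only [and_true]
    omega
  · rintro ⟨⟨m, n⟩, ⟨p, i⟩, ⟨t, q'⟩, ⟨q, j⟩⟩ h
    simp only [mem_sigma, HasAntidiagonal.mem_antidiagonal] at h ⊢
    obtain ⟨-, rfl, rfl, rfl⟩ := h
    rfl
  · rintro ⟨⟨m, n⟩, ⟨p, q⟩, ⟨t, q'⟩, ⟨i, j⟩⟩ h
    simp only [mem_sigma, HasAntidiagonal.mem_antidiagonal] at h ⊢
    obtain ⟨-, rfl, rfl, rfl⟩ := h
    rfl
  · rintro ⟨⟨m, n⟩, ⟨p, i⟩, ⟨t, q'⟩, ⟨q, j⟩⟩ h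
    simp only [mem_sigma, HasAntidiagonal.mem_antidiagonal] at h ⊢
    obtain ⟨-, rfl, rfl, rfl⟩ := h
    rfl

theorem flip_mul (X Y : FormalAB) : flip (X * Y) = flip Y * flip X :=
  act_injective fun d r => by
    rw [act_flip, coact_mul, act_mul, ← Nat.sum_antidiagonal_swap]
    exact sum_congr rfl fun s _ => by rw [act_flip, act_flip]; rfl

theorem flip_add (X Y : FormalAB) : flip (X + Y) = flip X + flip Y := by
  ext m n
  simp only [coeff_flip, coeff_add, mul_add, sum_add_distrib]

theorem coeff_flip_zero_right (X : FormalAB) (m : ℕ) :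
    (flip X).coeff m 0 = X.coeff m 0 := by
  simp [coeff_flip, Gam_zero_right]

theorem Gam_zero_succ (p j : ℕ) : Gam p 0 (j + 1) = 0 := by simp [Gam]

theorem flip_b : flip b = -b := by
  refine act_injective fun d r => ?_
  have hneg : act (-b) d r = - act b d r := by simp [act]
  rw [act_flip, hneg, b, act_mono, coact]
  split_ifs with h
  · subst h
    simp [Nat.antidiagonal_succ, mono]
  · rw [neg_zero]
    refine sum_eq_zero fun s hs => ?_
    have h1 := HasAntidiagonal.mem_antidiagonal.1 hs
    have h3 : ¬ (s.1 = 0 ∧ s.2 = 1) := by omega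
    simp [mono, h3]

/-- The factor `4` in the new radius is one `2` from `Gam_bound` and one `2` for the number `n + 1 ≤
2^n` of summands. -/
theorem IsConv.flip {X : FormalAB} (hX : IsConv X) : IsConv (flip X) := by
  obtain ⟨R, hR, C, h⟩ := hX
  have hC : 0 ≤ C := by simpa using (norm_nonneg _).trans (h 0 0)
  have hR0 : 0 ≤ R := by linarith
  refine ⟨4 * R, by linarith, C, fun m n => ?_⟩
  rw [coeff_flip, norm_mul, norm_pow, norm_neg, norm_one, one_pow, one_mul]
  have term : ∀ w ∈ antidiagonal n, ‖(Gam (m + w.2) w.1 w.2 : ℂ) * X.coeff (m + w.2) w.1‖ ≤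
      C * R ^ (m + n) * (2 ^ (m + n) * n.factorial) := by
    rintro ⟨q, j⟩ hw
    have hw := HasAntidiagonal.mem_antidiagonal.1 hw
    simp only at hw ⊢
    subst hw
    have hG := Gam_bound m q j 0
    rw [Nat.factorial_zero, mul_one, add_zero] at hG
    have hG : (Gam (m + j) q j : ℝ) * q.factorial ≤ 2 ^ (m + j) * (q + j).factorial := by
      exact_mod_cast hG
    rw [norm_mul, Complex.norm_natCast]
    calc (Gam (m + j) q j : ℝ) * ‖X.coeff (m + j) q‖
        ≤ (Gam (m + j) q j : ℝ) * (C * R ^ (m + j + q) * q.factorial) := by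
          have := h (m + j) q
          gcongr
      _ = C * R ^ (m + (q + j)) * ((Gam (m + j) q j : ℝ) * q.factorial) := by ring
      _ ≤ C * R ^ (m + (q + j)) * (2 ^ (m + j) * (q + j).factorial) := by gcongr
      _ ≤ C * R ^ (m + (q + j)) * (2 ^ (m + (q + j)) * (q + j).factorial) := by
          gcongr
          · norm_num
          · omega
  refine (norm_sum_le_of_le _ term).trans ?_
  rw [sum_const, Nat.card_antidiagonal, nsmul_eq_mul]
  have h1 : ((n + 1 : ℕ) : ℝ) ≤ 2 ^ (m + n) := by
    have : n + 1 ≤ 2 ^ n := Nat.lt_two_pow_self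
    have h2 : (2 : ℕ) ^ n ≤ 2 ^ (m + n) := Nat.pow_le_pow_right (by norm_num) (by omega)
    exact_mod_cast this.trans h2
  calc ((n + 1 : ℕ) : ℝ) * (C * R ^ (m + n) * (2 ^ (m + n) * n.factorial))
      ≤ 2 ^ (m + n) * (C * R ^ (m + n) * (2 ^ (m + n) * n.factorial)) := by gcongr
    _ = C * (4 * R) ^ (m + n) * n.factorial := by
        rw [mul_pow, show (4 : ℝ) = 2 * 2 by norm_num, mul_pow]; ring

end FormalAB

namespace FormalAB

open Finset

/-! ### Truncated Beta integrals as weights -/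

/-- `∫_c^1 t^p (1 - t)^n / n! dt`. -/
noncomputable def betaWeight (c : ℝ) (p n : ℕ) : ℝ :=
  ∫ t in c..1, t ^ p * ((1 - t) ^ n / n.factorial)

/-- The image of `(1 - t)^n / n!` under the majorant of the operator `b^m a^p`. -/
noncomputable def betaKernel (p n m : ℕ) (t : ℝ) : ℝ :=
  ∑ j ∈ range (p + 1), (Gam p m j : ℝ) *
    (t ^ (p - j) * ((1 - t) ^ (m + j + n) / (m + j + n).factorial))

theorem hasDerivAt_one_sub_pow_div (n : ℕ) (t : ℝ) :
    HasDerivAt (fun t : ℝ => (1 - t) ^ (n + 1) / (n + 1).factorial)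
      (-((1 - t) ^ n / n.factorial)) t := by
  have h := (((hasDerivAt_id t).const_sub 1).pow (n + 1)).div_const ((n + 1).factorial : ℝ)
  refine h.congr_deriv ?_
  have n1 : (n.factorial : ℝ) ≠ 0 := by exact_mod_cast Nat.factorial_ne_zero _
  have n2 : ((n : ℝ) + 1) ≠ 0 := by positivity
  rw [Nat.factorial_succ]
  push_cast
  simp only [id]
  field_simp

theorem hasDerivAt_sub_pow_div (c : ℝ) (n : ℕ) (t : ℝ) :
    HasDerivAt (fun t : ℝ => (t - c) ^ (n + 1) / (n + 1).factorial)
      ((t - c) ^ n / n.factorial) t := by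
  have h := (((hasDerivAt_id t).sub_const c).pow (n + 1)).div_const ((n + 1).factorial : ℝ)
  refine h.congr_deriv ?_
  have n1 : (n.factorial : ℝ) ≠ 0 := by exact_mod_cast Nat.factorial_ne_zero _
  have n2 : ((n : ℝ) + 1) ≠ 0 := by positivity
  rw [Nat.factorial_succ]
  push_cast
  simp only [id]
  field_simp

/-- Differentiating `t^(p-j)` in the term `j` produces a multiple of the monomial of the term `j +
1`; the Pascal rule for `multichoose` combines the two. As the kernel vanishes at `1` for positive
`m`, it is the `m`-fold iterated integral from `t` to `1` of `t^p (1-t)^n / n!`. -/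
theorem hasDerivAt_betaKernel (p n m : ℕ) (t : ℝ) :
    HasDerivAt (betaKernel p n (m + 1)) (-betaKernel p n m t) t := by
  let g : ℕ → ℝ := fun j => t ^ (p - j) * ((1 - t) ^ (m + j + n) / (m + j + n).factorial)
  have hterm : ∀ j ∈ range (p + 1), HasDerivAt (fun t : ℝ => (Gam p (m + 1) j : ℝ) *
      (t ^ (p - j) * ((1 - t) ^ (m + 1 + j + n) / (m + 1 + j + n).factorial)))
      (((m + 1).multichoose j * p.descFactorial (j + 1) : ℕ) * g (j + 1) -
        (Gam p (m + 1) j : ℝ) * g j) t := by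
    intro j hj
    have h1 := hasDerivAt_one_sub_pow_div (m + j + n) t
    rw [show m + j + n + 1 = m + 1 + j + n by omega] at h1
    refine (((hasDerivAt_pow (p - j) t).mul h1).const_mul _).congr_deriv ?_
    simp only [g, Gam, Nat.descFactorial_succ, show m + (j + 1) + n = m + 1 + j + n by omega,
      show p - (j + 1) = p - j - 1 by omega]
    push_cast
    ring
  have h := HasDerivAt.fun_sum hterm
  refine h.congr_deriv ?_
  rw [sum_sub_distrib, sum_range_succ, Nat.descFactorial_eq_zero_iff_lt.2 (Nat.lt_succ_self p),
    mul_zero, Nat.cast_zero, zero_mul, add_zero, betaKernel, sum_range_succ', sum_range_succ' _ p,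
    Gam_zero_right, Gam_zero_right, ← sub_sub, ← sum_sub_distrib, neg_add, ← sum_neg_distrib,
    ← sub_eq_add_neg]
  congr 1
  refine sum_congr rfl fun j _ => ?_
  have h2 : (Gam p (m + 1) (j + 1) : ℝ) = Gam p m (j + 1) +
      ((m + 1).multichoose j * p.descFactorial (j + 1) : ℕ) := by
    rw [Gam, Gam, Nat.multichoose_succ_succ]
    push_cast
    ring
  rw [h2]
  ring

theorem betaKernel_zero (p n : ℕ) (t : ℝ) :
    betaKernel p n 0 t = t ^ p * ((1 - t) ^ n / n.factorial) := by
  rw [betaKernel, sum_range_succ', sum_eq_zero fun j _ => by rw [Gam_zero_succ]; simp]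
  simp [Gam_zero_right]

theorem betaKernel_one (p n m : ℕ) : betaKernel p n (m + 1) 1 = 0 := by
  refine sum_eq_zero fun j _ => ?_
  rw [sub_self, zero_pow (by omega), zero_div, mul_zero, mul_zero]

theorem continuous_betaKernel (p n m : ℕ) : Continuous (betaKernel p n m) := by
  unfold betaKernel
  fun_prop

/-- Cauchy's formula for iterated integrals. Each integration by parts moves one integration onto
the power of `t - c`; the boundary terms vanish, at `c` by that power and at `1` by the kernel. -/
theorem integral_betaKernel (c : ℝ) (p n m i : ℕ) :
    ∫ t in c..1, (t - c) ^ i / i.factorial * betaKernel p n m t =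
      ∫ t in c..1, (t - c) ^ (i + m) / (i + m).factorial * (t ^ p * ((1 - t) ^ n / n.factorial)) := by
  induction m generalizing i with
  | zero => simp only [betaKernel_zero, add_zero]
  | succ m ih =>
    have h := intervalIntegral.integral_mul_deriv_eq_deriv_mul (a := c) (b := 1)
      (u := fun t => (t - c) ^ (i + 1) / (i + 1).factorial) (v := betaKernel p n (m + 1))
      (u' := fun t => (t - c) ^ i / i.factorial) (v' := fun t => -betaKernel p n m t)
      (fun t _ => hasDerivAt_sub_pow_div c i t) (fun t _ => hasDerivAt_betaKernel p n m t)
      (Continuous.intervalIntegrable (by fun_prop) _ _)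
      (Continuous.intervalIntegrable (continuous_betaKernel p n m).neg _ _)
    simp only [betaKernel_one, sub_self, zero_pow (Nat.succ_ne_zero i), zero_div, zero_mul,
      mul_zero, mul_neg, intervalIntegral.integral_neg, zero_sub, neg_inj] at h
    rw [← h, ih (i + 1), show i + 1 + m = i + (m + 1) by omega]

theorem sum_Gam_mul_betaWeight (c : ℝ) (p n m : ℕ) :
    ∑ s ∈ antidiagonal p, (Gam p m s.2 : ℝ) * betaWeight c s.1 (m + s.2 + n) =
      ∫ t in c..1, (t - c) ^ m / m.factorial * (t ^ p * ((1 - t) ^ n / n.factorial)) := by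
  have h := integral_betaKernel c p n m 0
  simp only [pow_zero, Nat.factorial_zero, Nat.cast_one, div_one, one_mul, zero_add] at h
  rw [← h, ← Nat.sum_antidiagonal_swap, Nat.sum_antidiagonal_eq_sum_range_succ_mk]
  unfold betaKernel
  rw [intervalIntegral.integral_finsetSum
    fun j _ => Continuous.intervalIntegrable (by fun_prop) _ _]
  refine sum_congr rfl fun j _ => ?_
  rw [intervalIntegral.integral_const_mul]
  rfl

section Bounds

variable {c : ℝ} (hc0 : 0 ≤ c) (hc1 : c ≤ 1)
include hc0 hc1

/-- The estimate that motivates the weights: the whole reordering sum becomes one integral with the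
extra factor `(t-c)^m / m!`, and `t - c ≤ 1 - c`. The bound does not deteriorate with `p`. -/
theorem sum_Gam_mul_betaWeight_le (p n m : ℕ) :
    ∑ s ∈ antidiagonal p, (Gam p m s.2 : ℝ) * betaWeight c s.1 (m + s.2 + n) ≤
      (1 - c) ^ m / m.factorial * betaWeight c p n := by
  rw [sum_Gam_mul_betaWeight, betaWeight, ← intervalIntegral.integral_const_mul]
  refine intervalIntegral.integral_mono_on hc1
    (Continuous.intervalIntegrable (by fun_prop) _ _)
    (Continuous.intervalIntegrable (by fun_prop) _ _) fun t ht => ?_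
  have h1 : 0 ≤ t - c := by linarith [ht.1]
  have h2 : 0 ≤ 1 - t := by linarith [ht.2]
  have h3 : 0 ≤ t := by linarith [ht.1]
  have h4 : t - c ≤ 1 - c := by linarith [ht.2]
  gcongr

theorem betaWeight_add_le (p n k : ℕ) : betaWeight c (k + p) n ≤ betaWeight c p n := by
  refine intervalIntegral.integral_mono_on hc1
    (Continuous.intervalIntegrable (by fun_prop) _ _)
    (Continuous.intervalIntegrable (by fun_prop) _ _) fun t ht => ?_
  have h2 : 0 ≤ 1 - t := by linarith [ht.2]
  have h3 : 0 ≤ t := by linarith [ht.1]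
  have h4 : t ^ (k + p) ≤ t ^ p := pow_le_pow_of_le_one h3 ht.2 (by omega)
  gcongr

theorem le_betaWeight_add (p n k : ℕ) :
    c ^ k * betaWeight c p n ≤ betaWeight c (p + k) n := by
  rw [betaWeight, betaWeight, ← intervalIntegral.integral_const_mul]
  refine intervalIntegral.integral_mono_on hc1
    (Continuous.intervalIntegrable (by fun_prop) _ _)
    (Continuous.intervalIntegrable (by fun_prop) _ _) fun t ht => ?_
  have h2 : 0 ≤ 1 - t := by linarith [ht.2]
  have h3 : 0 ≤ t := by linarith [ht.1]
  have h4 : c ^ k ≤ t ^ k := pow_le_pow_left₀ hc0 ht.1 k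
  calc c ^ k * (t ^ p * ((1 - t) ^ n / n.factorial))
      ≤ t ^ k * (t ^ p * ((1 - t) ^ n / n.factorial)) := by gcongr
    _ = t ^ (p + k) * ((1 - t) ^ n / n.factorial) := by rw [pow_add]; ring

theorem betaWeight_le (p n : ℕ) : betaWeight c p n ≤ 1 / n.factorial := by
  have h : betaWeight c p n ≤ ∫ _ in c..1, (1 / n.factorial : ℝ) := by
    refine intervalIntegral.integral_mono_on hc1
      (Continuous.intervalIntegrable (by fun_prop) _ _)
      (Continuous.intervalIntegrable (by fun_prop) _ _) fun t ht => ?_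
    have h2 : 0 ≤ 1 - t := by linarith [ht.2]
    have h3 : 0 ≤ t := by linarith [ht.1]
    calc t ^ p * ((1 - t) ^ n / n.factorial) ≤ 1 * (1 / n.factorial) := by
          have := pow_le_one₀ h3 ht.2 (n := p)
          have := pow_le_one₀ h2 (by linarith) (n := n)
          gcongr
      _ = _ := one_mul _
  refine h.trans ?_
  rw [intervalIntegral.integral_const, smul_eq_mul]
  exact mul_le_of_le_one_left (by positivity) (by linarith)

theorem le_betaWeight (p n : ℕ) :
    c ^ p * ((1 - c) ^ (n + 1) / (n + 1).factorial) ≤ betaWeight c p n := by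
  have h : ∫ t in c..1, c ^ p * ((1 - t) ^ n / n.factorial) ≤ betaWeight c p n := by
    refine intervalIntegral.integral_mono_on hc1
      (Continuous.intervalIntegrable (by fun_prop) _ _)
      (Continuous.intervalIntegrable (by fun_prop) _ _) fun t ht => ?_
    have h2 : 0 ≤ 1 - t := by linarith [ht.2]
    have := pow_le_pow_left₀ hc0 ht.1 p
    gcongr
  refine le_trans (le_of_eq ?_) h
  rw [intervalIntegral.integral_const_mul,
    intervalIntegral.integral_eq_sub_of_hasDerivAt
      (f := fun t => -((1 - t) ^ (n + 1) / (n + 1).factorial))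
      (fun t _ => (hasDerivAt_one_sub_pow_div n t).neg.congr_deriv (neg_neg _))
      (Continuous.intervalIntegrable (by fun_prop) _ _)]
  simp

end Bounds

end FormalAB

namespace FormalAB

open Finset Filter Topology
open scoped ENNReal

/-! ### Weighted `ℓ¹` norms -/

/-- The weighted `ℓ¹` norm, with values in `[0, ∞]`. -/
noncomputable def wnorm (w : ℕ → ℕ → ℝ≥0∞) (X : FormalAB) : ℝ≥0∞ :=
  ∑' p, ∑' q, ‖X.coeff p q‖ₑ * w p q

theorem tsum_antidiagonal (f : ℕ → ℕ → ℝ≥0∞) :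
    ∑' n, ∑ u ∈ antidiagonal n, f u.1 u.2 = ∑' i, ∑' j, f i j := by
  rw [← ENNReal.tsum_prod, ← HasAntidiagonal.sigmaAntidiagonalEquivProd.tsum_eq]
  refine Eq.trans ?_
    (ENNReal.tsum_sigma' fun x : (Σ n : ℕ, antidiagonal n) => f x.2.1.1 x.2.1.2).symm
  exact tsum_congr fun n => (Finset.tsum_subtype (antidiagonal n) fun u => f u.1 u.2).symm

theorem tsum_sum_comm {ι : Type*} (s : Finset ι) (f : ℕ → ι → ℝ≥0∞) :
    ∑' n, ∑ u ∈ s, f n u = ∑ u ∈ s, ∑' n, f n u :=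
  Summable.tsum_finsetSum fun _ _ => ENNReal.summable

theorem enorm_coeff_mul_le (X Y : FormalAB) (m n : ℕ) : ‖(X * Y).coeff m n‖ₑ ≤
    ∑ u ∈ antidiagonal m, ∑ v ∈ antidiagonal n, ∑ z ∈ antidiagonal v.1,
      (Gam (u.2 + z.2) z.1 z.2 : ℝ≥0∞) *
        (‖X.coeff u.1 z.1‖ₑ * ‖Y.coeff (u.2 + z.2) v.2‖ₑ) := by
  rw [coeff_mul]
  refine (enorm_sum_le _ _).trans (sum_le_sum fun u _ => (enorm_sum_le _ _).trans
    (sum_le_sum fun v _ => (enorm_sum_le _ _).trans (sum_le_sum fun z _ => le_of_eq ?_)))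
  have h1 : ‖(-1 : ℂ) ^ z.2‖ₑ = 1 := by simp [enorm_pow]
  have h2 : ∀ n : ℕ, ‖(n : ℂ)‖ₑ = n := fun n => by
    rw [← ofReal_norm, Complex.norm_natCast, ENNReal.ofReal_natCast]
  rw [enorm_mul, enorm_mul, enorm_mul, h1, h2, one_mul]

/-- The hypothesis bounds `a^P b^m` as a left multiplier on each monomial `a^p b^n`; since the norm
is of `ℓ¹` type, summing over monomials suffices. The proof regroups the terms by `i + j = p'`, the
exponent of `a` in the monomial of `Y`. -/
theorem wnorm_mul_le {w K : ℕ → ℕ → ℝ≥0∞}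
    (h : ∀ P m p n, ∑ s ∈ antidiagonal p, (Gam p m s.2 : ℝ≥0∞) * w (P + s.1) (m + s.2 + n) ≤
      K P m * w p n) (X Y : FormalAB) : wnorm w (X * Y) ≤ wnorm K X * wnorm w Y := by
  let F : ℕ → ℕ → ℕ → ℕ → ℕ → ℝ≥0∞ := fun p i q j q' =>
    (Gam (i + j) q j : ℝ≥0∞) * (‖X.coeff p q‖ₑ * ‖Y.coeff (i + j) q'‖ₑ) * w (p + i) (q + j + q')
  have h1 : wnorm w (X * Y) ≤ ∑' m, ∑' n, ∑ u ∈ antidiagonal m, ∑ v ∈ antidiagonal n,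
      ∑ z ∈ antidiagonal v.1, F u.1 u.2 z.1 z.2 v.2 := by
    refine ENNReal.tsum_le_tsum fun m => ENNReal.tsum_le_tsum fun n => ?_
    refine (mul_le_mul_left (enorm_coeff_mul_le X Y m n) (w m n)).trans (le_of_eq ?_)
    simp only [sum_mul]
    refine sum_congr rfl fun u hu => sum_congr rfl fun v hv => sum_congr rfl fun z hz => ?_
    simp only [F, HasAntidiagonal.mem_antidiagonal.1 hu, HasAntidiagonal.mem_antidiagonal.1 hz,
      HasAntidiagonal.mem_antidiagonal.1 hv]
  have h2 : ∑' m, ∑' n, ∑ u ∈ antidiagonal m, ∑ v ∈ antidiagonal n,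
      ∑ z ∈ antidiagonal v.1, F u.1 u.2 z.1 z.2 v.2 =
      ∑' p, ∑' i, ∑' q', ∑' q, ∑' j, F p i q j q' := by
    simp only [tsum_sum_comm]
    rw [tsum_antidiagonal fun p i => ∑' n, ∑ v ∈ antidiagonal n, ∑ z ∈ antidiagonal v.1,
      F p i z.1 z.2 v.2]
    refine tsum_congr fun p => tsum_congr fun i => ?_
    rw [tsum_antidiagonal fun t q' => ∑ z ∈ antidiagonal t, F p i z.1 z.2 q', ENNReal.tsum_comm]
    exact tsum_congr fun q' => tsum_antidiagonal fun q j => F p i q j q'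
  have h3 : ∀ p q q', ∑' i, ∑' j, F p i q j q' ≤
      (‖X.coeff p q‖ₑ * K p q) * ∑' p', ‖Y.coeff p' q'‖ₑ * w p' q' := by
    intro p q q'
    rw [← tsum_antidiagonal fun i j => F p i q j q', ← ENNReal.tsum_mul_left]
    refine ENNReal.tsum_le_tsum fun p' => ?_
    calc ∑ s ∈ antidiagonal p', F p s.1 q s.2 q'
        = ∑ s ∈ antidiagonal p', ‖X.coeff p q‖ₑ * ‖Y.coeff p' q'‖ₑ *
            ((Gam p' q s.2 : ℝ≥0∞) * w (p + s.1) (q + s.2 + q')) := by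
          refine sum_congr rfl fun s hs => ?_
          simp only [F, HasAntidiagonal.mem_antidiagonal.1 hs]
          ring
      _ ≤ ‖X.coeff p q‖ₑ * ‖Y.coeff p' q'‖ₑ * (K p q * w p' q') := by
          rw [← mul_sum]
          gcongr
          exact h p q p' q'
      _ = _ := by ring
  calc wnorm w (X * Y) ≤ ∑' p, ∑' i, ∑' q', ∑' q, ∑' j, F p i q j q' := h1.trans h2.le
    _ = ∑' p, ∑' q, ∑' q', ∑' i, ∑' j, F p i q j q' := by
        refine tsum_congr fun p => ?_
        rw [ENNReal.tsum_comm, ENNReal.tsum_comm (f := fun q q' => ∑' i, ∑' j, F p i q j q')]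
        exact tsum_congr fun q' => ENNReal.tsum_comm
    _ ≤ ∑' p, ∑' q, ∑' q', (‖X.coeff p q‖ₑ * K p q) * ∑' p', ‖Y.coeff p' q'‖ₑ * w p' q' :=
        ENNReal.tsum_le_tsum fun p => ENNReal.tsum_le_tsum fun q =>
          ENNReal.tsum_le_tsum fun q' => h3 p q q'
    _ = wnorm K X * wnorm w Y := by
        simp only [ENNReal.tsum_mul_left, ENNReal.tsum_mul_right]
        rw [wnorm, wnorm, ENNReal.tsum_comm (f := fun q' p' => ‖Y.coeff p' q'‖ₑ * w p' q')]

theorem enorm_coeff_mul_le_wnorm (w : ℕ → ℕ → ℝ≥0∞) (X : FormalAB) (p n : ℕ) :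
    ‖X.coeff p n‖ₑ * w p n ≤ wnorm w X :=
  (ENNReal.le_tsum (f := fun n => ‖X.coeff p n‖ₑ * w p n) n).trans
    (ENNReal.le_tsum (f := fun p => ∑' n, ‖X.coeff p n‖ₑ * w p n) p)

theorem coeff_sum {ι : Type*} (s : Finset ι) (f : ι → FormalAB) (p n : ℕ) :
    (∑ i ∈ s, f i).coeff p n = ∑ i ∈ s, (f i).coeff p n := by
  classical
  induction s using Finset.induction_on with
  | empty => simp
  | insert i s hi ih => rw [sum_insert hi, sum_insert hi, coeff_add, ih]

/-! ### Neumann series in the weighted norms. -/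

/-- Coefficientwise convergence. -/
def CoeffTendsto (S : ℕ → FormalAB) (X : FormalAB) : Prop :=
  ∀ p n, Tendsto (fun M => (S M).coeff p n) atTop (𝓝 (X.coeff p n))

theorem CoeffTendsto.mul_left {S : ℕ → FormalAB} {X : FormalAB} (h : CoeffTendsto S X)
    (U : FormalAB) : CoeffTendsto (fun M => U * S M) (U * X) := by
  intro m n
  simp only [coeff_mul]
  exact tendsto_finsetSum _ fun u _ => tendsto_finsetSum _ fun v _ => tendsto_finsetSum _
    fun z _ => ((h _ _).const_mul _).const_mul _

/-- A contraction for a weighted norm which is continuous for coefficientwise convergence: the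
Neumann series solves the fixed point equation. -/
theorem exists_eq_add_map {w : ℕ → ℕ → ℝ≥0∞} (hw : ∀ p n, w p n ≠ 0) (L : FormalAB →+ FormalAB)
    (hL : ∀ X, wnorm w (L X) ≤ 2⁻¹ * wnorm w X)
    (hcont : ∀ S X, CoeffTendsto S X → CoeffTendsto (fun M => L (S M)) (L X))
    {y : FormalAB} (hy : wnorm w y ≠ ⊤) : ∃ q, q = y + L q ∧ wnorm w q ≠ ⊤ := by
  let s : ℕ → FormalAB := fun i => L^[i] y
  have hs : ∀ i, s (i + 1) = L (s i) := fun i => Function.iterate_succ_apply' _ _ _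
  have hsnorm : ∀ i, wnorm w (s i) ≤ 2⁻¹ ^ i * wnorm w y := by
    intro i
    induction i with
    | zero => simp [s]
    | succ i ih =>
      rw [hs, pow_succ', mul_assoc]
      exact (hL _).trans (by gcongr)
  have htot : ∑' i, wnorm w (s i) ≠ ⊤ := by
    refine ne_top_of_le_ne_top ?_ (ENNReal.tsum_le_tsum hsnorm)
    rw [ENNReal.tsum_mul_right, ENNReal.tsum_geometric, ENNReal.one_sub_inv_two, inv_inv]
    exact ENNReal.mul_ne_top (by simp) hy
  have hsum : ∀ p n, Summable fun i => (s i).coeff p n := by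
    intro p n
    have h1 : (∑' i, ‖(s i).coeff p n‖ₑ) * w p n ≠ ⊤ := by
      refine ne_top_of_le_ne_top htot ?_
      rw [← ENNReal.tsum_mul_right]
      exact ENNReal.tsum_le_tsum fun i => enorm_coeff_mul_le_wnorm w (s i) p n
    -- Nonvanishing weights turn summability of the norms into summability of each coefficient.
    have h2 : (∑' i, ‖(s i).coeff p n‖ₑ) ≠ ⊤ := fun h => h1 (by rw [h, ENNReal.top_mul (hw p n)])
    exact (tsum_enorm_ne_top_iff_summable_norm.1 h2).of_norm
  let q : FormalAB := ⟨fun p n => ∑' i, (s i).coeff p n⟩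
  have hq : CoeffTendsto (fun M => ∑ i ∈ range M, s i) q := by
    intro p n
    simp only [coeff_sum]
    exact (hsum p n).hasSum.tendsto_sum_nat
  refine ⟨q, ?_, ?_⟩
  · ext p n
    -- The partial sums satisfy `S (M + 1) = y + L (S M)`; both sides converge coefficientwise.
    have h1 := (hcont _ _ hq p n).const_add (y.coeff p n)
    have h2 := (tendsto_add_atTop_iff_nat 1).2 (hq p n)
    refine tendsto_nhds_unique h2 (h1.congr fun M => ?_)
    simp only [sum_range_succ', map_sum, ← coeff_add, hs]
    rw [add_comm]
    rfl
  · refine ne_top_of_le_ne_top htot ?_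
    have h1 : wnorm w q ≤ ∑' p, ∑' n, ∑' i, ‖(s i).coeff p n‖ₑ * w p n := by
      refine ENNReal.tsum_le_tsum fun p => ENNReal.tsum_le_tsum fun n => ?_
      rw [ENNReal.tsum_mul_right]
      gcongr
      exact enorm_tsum_le_tsum_enorm
    refine h1.trans (le_of_eq ?_)
    simp only [wnorm]
    rw [ENNReal.tsum_comm (f := fun i p => ∑' n, ‖(s i).coeff p n‖ₑ * w p n)]
    exact tsum_congr fun p => ENNReal.tsum_comm

/-! ### Dividing on the left by a power of `a`. -/

/-- Left division by `a^k`, forgetting the remainder. -/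
def shiftA (k : ℕ) : FormalAB →+ FormalAB where
  toFun X := ⟨fun p n => X.coeff (p + k) n⟩
  map_zero' := rfl
  map_add' _ _ := rfl

theorem coeff_shiftA (k : ℕ) (X : FormalAB) (p n : ℕ) :
    (shiftA k X).coeff p n = X.coeff (p + k) n := rfl

theorem wnorm_shiftA_le {w : ℕ → ℕ → ℝ≥0∞} {D : ℝ≥0∞} {k : ℕ}
    (h : ∀ p n, w p n ≤ D * w (p + k) n) (X : FormalAB) :
    wnorm w (shiftA k X) ≤ D * wnorm w X := by
  have h1 : wnorm w (shiftA k X) ≤ ∑' p, D * ∑' n, ‖X.coeff (p + k) n‖ₑ * w (p + k) n := by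
    refine ENNReal.tsum_le_tsum fun p => ?_
    rw [← ENNReal.tsum_mul_left]
    refine ENNReal.tsum_le_tsum fun n => ?_
    rw [coeff_shiftA, mul_left_comm]
    gcongr
    exact h p n
  rw [ENNReal.tsum_mul_left] at h1
  refine h1.trans ?_
  gcongr
  exact ENNReal.tsum_comp_le_tsum_of_injective (add_left_injective k)
    (fun p => ∑' n, ‖X.coeff p n‖ₑ * w p n)

theorem coeff_mono_mul (k : ℕ) (X : FormalAB) (m n : ℕ) :
    (mono k 0 * X).coeff m n = if k ≤ m then X.coeff (m - k) n else 0 := by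
  rw [coeff_mul]
  have hterm : ∀ u ∈ antidiagonal m, ∑ v ∈ antidiagonal n, ∑ w ∈ antidiagonal v.1,
      (-1 : ℂ) ^ w.2 * (Gam (u.2 + w.2) w.1 w.2 : ℂ)
        * ((mono k 0).coeff u.1 w.1 * X.coeff (u.2 + w.2) v.2) =
      if u.1 = k then X.coeff u.2 n else 0 := by
    intro u _
    rw [sum_eq_single (0, n)]
    · simp [mono, Gam_zero_right]
    · rintro ⟨t, q'⟩ h1 h2
      have h1 := HasAntidiagonal.mem_antidiagonal.1 h1
      refine sum_eq_zero ?_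
      rintro ⟨q, j⟩ h3
      have h3 := HasAntidiagonal.mem_antidiagonal.1 h3
      rcases q with _ | q
      · rcases j with _ | j
        · exact absurd (Prod.ext (by simp only at *; omega) (by simp only at *; omega)) h2
        · simp [Gam_zero_succ]
      · simp [mono]
    · simp
  rw [sum_congr rfl hterm]
  split_ifs with h
  · rw [sum_eq_single (k, m - k)]
    · simp
    · rintro ⟨i, j⟩ h1 h2
      have h1 := HasAntidiagonal.mem_antidiagonal.1 h1
      rw [if_neg]
      rintro rfl
      exact h2 (Prod.ext rfl (by simp only at *; omega))
    · intro h1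
      exact absurd (HasAntidiagonal.mem_antidiagonal.2 (by omega)) h1
  · refine sum_eq_zero fun u hu => if_neg ?_
    have := HasAntidiagonal.mem_antidiagonal.1 hu
    omega

end FormalAB

namespace FormalAB

open Finset Filter Topology
open scoped ENNReal

/-! ### The division theorem -/

theorem coeff_sub (X Y : FormalAB) (p q : ℕ) :
    (X - Y).coeff p q = X.coeff p q - Y.coeff p q := by
  rw [sub_eq_add_neg, coeff_add, coeff_neg, sub_eq_add_neg]

/-- The weights `l^(p+n) ∫_c^1 t^p (1 - t)^n / n! dt`. -/
noncomputable def divWeight (l c : ℝ) (p n : ℕ) : ℝ≥0∞ :=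
  ENNReal.ofReal (l ^ (p + n) * betaWeight c p n)

/-- The weights bounding left multiplication in the norm defined by `divWeight`. -/
noncomputable def opWeight (l c : ℝ) (p n : ℕ) : ℝ≥0∞ :=
  ENNReal.ofReal (l ^ (p + n) * ((1 - c) ^ n / n.factorial))

theorem betaWeight_pos {c : ℝ} (hc0 : 0 < c) (hc1 : c < 1) (p n : ℕ) : 0 < betaWeight c p n := by
  refine lt_of_lt_of_le ?_ (le_betaWeight hc0.le hc1.le p n)
  have : 0 < 1 - c := by linarith
  positivity

/-- The commutation relation is homogeneous, so the power of `l` factors out. The extra `a^P` can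
only decrease the integral because `t ≤ 1`, and `sum_Gam_mul_betaWeight_le` handles the reordering.
-/
theorem wnorm_mul_le_opWeight {l c : ℝ} (hl : 0 < l) (hc0 : 0 < c) (hc1 : c < 1)
    (X Y : FormalAB) :
    wnorm (divWeight l c) (X * Y) ≤ wnorm (opWeight l c) X * wnorm (divWeight l c) Y := by
  refine wnorm_mul_le (fun P m p n => ?_) X Y
  have hpos : 0 < 1 - c := by linarith
  have h1 : ∀ s ∈ antidiagonal p, (Gam p m s.2 : ℝ≥0∞) * divWeight l c (P + s.1) (m + s.2 + n) =
      ENNReal.ofReal (Gam p m s.2 * (l ^ (P + s.1 + (m + s.2 + n)) *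
        betaWeight c (P + s.1) (m + s.2 + n))) := by
    intro s _
    rw [divWeight, ENNReal.ofReal_mul (Nat.cast_nonneg _), ENNReal.ofReal_natCast]
  rw [sum_congr rfl h1, ← ENNReal.ofReal_sum_of_nonneg, opWeight, divWeight,
    ← ENNReal.ofReal_mul (by positivity)]
  · refine ENNReal.ofReal_le_ofReal ?_
    calc ∑ s ∈ antidiagonal p, (Gam p m s.2 : ℝ) * (l ^ (P + s.1 + (m + s.2 + n)) *
          betaWeight c (P + s.1) (m + s.2 + n))
        ≤ ∑ s ∈ antidiagonal p, l ^ (P + m + (p + n)) * ((Gam p m s.2 : ℝ) *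
          betaWeight c s.1 (m + s.2 + n)) := by
          refine sum_le_sum fun s hs => ?_
          have hs := HasAntidiagonal.mem_antidiagonal.1 hs
          rw [show P + s.1 + (m + s.2 + n) = P + m + (p + n) by omega, mul_left_comm]
          have := betaWeight_add_le hc0.le hc1.le s.1 (m + s.2 + n) P
          gcongr
      _ ≤ l ^ (P + m + (p + n)) * ((1 - c) ^ m / m.factorial * betaWeight c p n) := by
          rw [← mul_sum]
          have := sum_Gam_mul_betaWeight_le hc0.le hc1.le p n m
          gcongr
      _ = l ^ (P + m) * ((1 - c) ^ m / m.factorial) * (l ^ (p + n) * betaWeight c p n) := by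
          rw [pow_add l (P + m)]; ring
  · intro s _
    have := betaWeight_pos hc0 hc1 (P + s.1) (m + s.2 + n)
    positivity

theorem divWeight_le_shift {l c : ℝ} (hl : 0 < l) (hc0 : 1 / 2 ≤ c) (hc1 : c < 1) (k p n : ℕ) :
    divWeight l c p n ≤ ENNReal.ofReal ((2 / l) ^ k) * divWeight l c (p + k) n := by
  rw [divWeight, divWeight, ← ENNReal.ofReal_mul (by positivity)]
  refine ENNReal.ofReal_le_ofReal ?_
  have h0 := le_betaWeight_add (by linarith) hc1.le p n k (c := c)
  have h1 : ((1 : ℝ) / 2) ^ k ≤ c ^ k := by gcongr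
  have h2 := (betaWeight_pos (by linarith) hc1 p n (c := c)).le
  have h3 : betaWeight c p n ≤ 2 ^ k * betaWeight c (p + k) n := by
    calc betaWeight c p n = 2 ^ k * (((1 : ℝ) / 2) ^ k * betaWeight c p n) := by
          rw [← mul_assoc, ← mul_pow]; norm_num
      _ ≤ 2 ^ k * (c ^ k * betaWeight c p n) := by gcongr
      _ ≤ _ := by gcongr
  calc l ^ (p + n) * betaWeight c p n ≤ l ^ (p + n) * (2 ^ k * betaWeight c (p + k) n) := by gcongr
    _ = (2 / l) ^ k * (l ^ (p + k + n) * betaWeight c (p + k) n) := by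
        rw [div_pow, show p + k + n = p + n + k by omega, pow_add l (p + n)]
        field_simp

theorem wnorm_le_of_geometric {w : ℕ → ℕ → ℝ} {X : FormalAB} {B : ℝ}
    (h : ∀ p n, ‖X.coeff p n‖ * w p n ≤ B * (1 / 2) ^ (p + n)) :
    wnorm (fun p n => ENNReal.ofReal (w p n)) X ≤ ENNReal.ofReal (4 * B) := by
  have hhalf : ENNReal.ofReal (1 / 2) = 2⁻¹ := by
    rw [one_div, ENNReal.ofReal_inv_of_pos (by norm_num)]; norm_num
  calc wnorm (fun p n => ENNReal.ofReal (w p n)) X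
      ≤ ∑' p : ℕ, ∑' n : ℕ, ENNReal.ofReal B * (2⁻¹ ^ p * 2⁻¹ ^ n) := by
        refine ENNReal.tsum_le_tsum fun p => ENNReal.tsum_le_tsum fun n => ?_
        rw [← ofReal_norm, ← ENNReal.ofReal_mul (norm_nonneg _), ← pow_add, ← hhalf,
          ← ENNReal.ofReal_pow (by norm_num), ← ENNReal.ofReal_mul' (by positivity)]
        exact ENNReal.ofReal_le_ofReal (h p n)
    _ = ENNReal.ofReal B * (2 * 2) := by
        simp only [ENNReal.tsum_mul_left, ENNReal.tsum_mul_right, ENNReal.tsum_geometric_two]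
    _ = ENNReal.ofReal (4 * B) := by
        rw [mul_comm 4, ENNReal.ofReal_mul' (by norm_num)]
        norm_num

theorem wnorm_divWeight_ne_top {X : FormalAB} {l c C R : ℝ} (hl : 0 < l) (hc0 : 0 < c)
    (hc1 : c < 1) (hC : 0 ≤ C) (hR : 0 ≤ R) (hRl : R * l ≤ 1 / 2)
    (h : ∀ p q, ‖X.coeff p q‖ ≤ C * R ^ (p + q) * q.factorial) :
    wnorm (divWeight l c) X ≠ ⊤ := by
  refine ne_top_of_le_ne_top ENNReal.ofReal_ne_top (wnorm_le_of_geometric (B := C) fun p n => ?_)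
  have h1 := betaWeight_le hc0.le hc1.le p n
  have h2 := (betaWeight_pos hc0 hc1 p n).le
  have h3 := h p n
  have n1 : (n.factorial : ℝ) ≠ 0 := by exact_mod_cast Nat.factorial_ne_zero _
  calc ‖X.coeff p n‖ * (l ^ (p + n) * betaWeight c p n)
      ≤ C * R ^ (p + n) * n.factorial * (l ^ (p + n) * (1 / n.factorial)) := by gcongr
    _ = C * (R * l) ^ (p + n) := by rw [mul_pow]; field_simp
    _ ≤ C * (1 / 2) ^ (p + n) := by gcongr

/-- A surviving term either is a pure power of `a` of exponent at least `k + 1`, or contains `b` and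
gains a factor `1 - c`. The `2` in `2 * R * l` pays for the geometric factor `(1/2)^(p+n)`. -/
theorem wnorm_opWeight_le {X : FormalAB} {l c C R : ℝ} {k : ℕ} (hl : 0 < l)
    (hc0 : 0 ≤ c) (hc1 : c < 1) (hC : 0 ≤ C) (hR : 0 ≤ R) (hRl : 2 * R * l ≤ 1)
    (hX0 : ∀ p ≤ k, X.coeff p 0 = 0)
    (h : ∀ p q, ‖X.coeff p q‖ ≤ C * R ^ (p + q) * q.factorial) :
    wnorm (opWeight l c) X ≤ ENNReal.ofReal (4 * (C * ((2 * R * l) ^ (k + 1) + (1 - c)))) := by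
  refine wnorm_le_of_geometric fun p n => ?_
  have hc : 0 < 1 - c := by linarith
  have n1 : (n.factorial : ℝ) ≠ 0 := by exact_mod_cast Nat.factorial_ne_zero _
  by_cases h0 : n = 0 ∧ p ≤ k
  · obtain ⟨rfl, hp⟩ := h0
    rw [hX0 p hp, norm_zero, zero_mul]
    positivity
  have h3 := h p n
  have key : (2 * R * l) ^ (p + n) * (1 - c) ^ n ≤ (2 * R * l) ^ (k + 1) + (1 - c) := by
    have hb : 0 ≤ 2 * R * l := by positivity
    rcases n with _ | n
    · rw [pow_zero, mul_one, add_zero]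
      have := pow_le_pow_of_le_one hb hRl (show k + 1 ≤ p by omega)
      linarith
    · have h4 := pow_le_one₀ hb hRl (n := p + (n + 1))
      have h5 : (1 - c) ^ (n + 1) ≤ 1 - c := pow_le_of_le_one hc.le (by linarith) (by omega)
      calc (2 * R * l) ^ (p + (n + 1)) * (1 - c) ^ (n + 1) ≤ 1 * (1 - c) := by gcongr
        _ ≤ _ := by
          have : 0 ≤ (2 * R * l) ^ (k + 1) := by positivity
          linarith
  calc ‖X.coeff p n‖ * (l ^ (p + n) * ((1 - c) ^ n / n.factorial))
      ≤ C * R ^ (p + n) * n.factorial * (l ^ (p + n) * ((1 - c) ^ n / n.factorial)) := by gcongr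
    _ = C * ((2 * R * l) ^ (p + n) * (1 - c) ^ n) * (1 / 2) ^ (p + n) := by
        rw [show C * ((2 * R * l) ^ (p + n) * (1 - c) ^ n) * (1 / 2) ^ (p + n) =
          C * (1 - c) ^ n * ((2 * R * l) ^ (p + n) * (1 / 2) ^ (p + n)) by ring, ← mul_pow,
          show 2 * R * l * (1 / 2) = R * l by ring, mul_pow]
        field_simp
    _ ≤ C * ((2 * R * l) ^ (k + 1) + (1 - c)) * (1 / 2) ^ (p + n) := by gcongr

/-- A finite norm bounds every coefficient by a constant over its weight, and `le_betaWeight` keeps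
the weight above a geometric term over `n!`. -/
theorem isConv_of_wnorm_ne_top {X : FormalAB} {l c : ℝ} (hl : 0 < l) (hl1 : l ≤ 1)
    (hc0 : 1 / 2 ≤ c) (hc1 : c < 1) (h : wnorm (divWeight l c) X ≠ ⊤) : IsConv X := by
  set d := 1 - c with hd
  have hd0 : 0 < d := by linarith
  have hd1 : d ≤ 1 / 2 := by linarith
  have hld : 0 < l * d := by positivity
  refine ⟨2 / (l * d), ?_, (wnorm (divWeight l c) X).toReal / d, fun p n => ?_⟩
  · rw [lt_div_iff₀ hld]
    nlinarith
  have h1 := enorm_coeff_mul_le_wnorm (divWeight l c) X p n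
  rw [← ENNReal.ofReal_toReal h, ← ofReal_norm, divWeight, ← ENNReal.ofReal_mul (norm_nonneg _),
    ENNReal.ofReal_le_ofReal_iff ENNReal.toReal_nonneg] at h1
  have h2 := le_betaWeight (by linarith) hc1.le p n (c := c)
  rw [← hd] at h2
  have n0 : (0 : ℝ) < n.factorial := by exact_mod_cast Nat.factorial_pos _
  have hfac : ((n + 1).factorial : ℝ) ≤ 2 ^ n * n.factorial := by
    rw [Nat.factorial_succ]
    have : n + 1 ≤ 2 ^ n := Nat.lt_two_pow_self
    exact_mod_cast Nat.mul_le_mul_right _ this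
  have h3 : (d / 2) ^ (p + n) * d / n.factorial ≤ betaWeight c p n := by
    refine le_trans ?_ h2
    rw [pow_add, pow_succ, div_pow d 2 n]
    calc (d / 2) ^ p * (d ^ n / 2 ^ n) * d / n.factorial
        = (d / 2) ^ p * (d ^ n * d / (2 ^ n * n.factorial)) := by field_simp
      _ ≤ c ^ p * (d ^ n * d / (n + 1).factorial) := by
          gcongr
          linarith
  have h4 : ‖X.coeff p n‖ * (l ^ (p + n) * ((d / 2) ^ (p + n) * d / n.factorial)) ≤
      (wnorm (divWeight l c) X).toReal := le_trans (by gcongr) h1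
  have e : l ^ (p + n) * ((d / 2) ^ (p + n) * d / n.factorial) =
      d / ((2 / (l * d)) ^ (p + n) * n.factorial) := by
    rw [div_pow, div_pow, mul_pow]
    field_simp
  rw [e, ← mul_div_assoc, div_le_iff₀ (by positivity)] at h4
  rw [div_mul_eq_mul_div, div_mul_eq_mul_div, le_div_iff₀ hd0, mul_assoc]
  exact h4

/-- Division on the right by a series whose reduction modulo `b` has order `k`. -/
theorem exists_division {X Y : FormalAB} (hX : IsConv X) (hY : IsConv Y) {k : ℕ}
    (hk : X.coeff k 0 ≠ 0) (hlt : ∀ p < k, X.coeff p 0 = 0) :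
    ∃ Q, IsConv Q ∧ ∀ p n, k ≤ p → (Y - X * Q).coeff p n = 0 := by
  set e : ℂ := (X.coeff k 0)⁻¹ with he
  have he0 : e ≠ 0 := inv_ne_zero hk
  -- Thus `e • X = a^k - U`, and `U` has no pure term `a^p` with `p ≤ k`.
  set U : FormalAB := mono k 0 + (-e) • X with hU
  obtain ⟨R₁, hR₁, C, hC, hUb⟩ := ((isConv_mono k 0).add (hX.smul (-e))).exists_ge
  obtain ⟨R₂, -, C₂, hC₂, hYb⟩ := (hY.smul e).exists_ge
  set R := max R₁ R₂
  have hR : 1 < R := lt_max_of_lt_left hR₁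
  have hUb := hUb R (le_max_left _ _)
  have hYb := hYb R (le_max_right _ _)
  have hU0 : ∀ p ≤ k, U.coeff p 0 = 0 := by
    intro p hp
    rw [hU, coeff_add, coeff_smul]
    rcases hp.lt_or_eq with hp | rfl
    · simp [mono, hp.ne, hlt p hp]
    · simp [mono, he, hk]
  -- The choice of `l` precedes that of `c`, because the bound required of `1 - c` involves `(2 /
  -- l)^k`. Each choice makes its share of the contraction constant at most `1/4`.
  obtain ⟨l, hl, hl1, hl2⟩ : ∃ l : ℝ, 0 < l ∧ 2 * R * l ≤ 1 ∧
      4 * (C * (4 * R) ^ k) * (2 * R * l) ≤ 1 / 4 := by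
    have hA : 0 ≤ C * (4 * R) ^ k := by positivity
    have e1 : 2 * R * (1 / (2 * R * (1 + 16 * (C * (4 * R) ^ k)))) =
        1 / (1 + 16 * (C * (4 * R) ^ k)) := by field_simp
    refine ⟨1 / (2 * R * (1 + 16 * (C * (4 * R) ^ k))), by positivity, ?_, ?_⟩
    · rw [e1, div_le_one (by positivity)]
      linarith
    · rw [e1, mul_one_div, div_le_iff₀ (by positivity)]
      linarith
  obtain ⟨c, hc0, hc1, hc2⟩ : ∃ c : ℝ, 1 / 2 ≤ c ∧ c < 1 ∧
      4 * (C * (2 / l) ^ k) * (1 - c) ≤ 1 / 4 := by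
    have hA : 0 ≤ C * (2 / l) ^ k := by positivity
    refine ⟨1 - 1 / (2 * (1 + 16 * (C * (2 / l) ^ k))), ?_, ?_, ?_⟩
    · have : 1 / (2 * (1 + 16 * (C * (2 / l) ^ k))) ≤ 1 / 2 := by
        gcongr
        linarith
      linarith
    · have : 0 < 1 / (2 * (1 + 16 * (C * (2 / l) ^ k))) := by positivity
      linarith
    · rw [sub_sub_cancel, mul_one_div, div_le_iff₀ (by positivity)]
      linarith
  have hcontr : ∀ Z, wnorm (divWeight l c) (shiftA k (U * Z)) ≤
      2⁻¹ * wnorm (divWeight l c) Z := by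
    intro Z
    have h1 := wnorm_shiftA_le (divWeight_le_shift hl hc0 hc1 k) (U * Z)
    have h2 := wnorm_mul_le_opWeight hl (by linarith) hc1 U Z
    have h3 := wnorm_opWeight_le (k := k) hl (by linarith) hc1 hC (by linarith) hl1 hU0 hUb
    have h4 : (2 / l) ^ k * (4 * (C * ((2 * R * l) ^ (k + 1) + (1 - c)))) ≤ 1 / 2 := by
      -- The exponent `k + 1` leaves one factor `l` after the cost `(2 / l)^k` of the shift.
      have e1 : (2 / l) ^ k * (2 * R * l) ^ (k + 1) = (4 * R) ^ k * (2 * R * l) := by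
        rw [pow_succ, ← mul_assoc, ← mul_pow]
        congr 2
        field_simp
        ring
      calc (2 / l) ^ k * (4 * (C * ((2 * R * l) ^ (k + 1) + (1 - c))))
          = 4 * C * ((2 / l) ^ k * (2 * R * l) ^ (k + 1)) +
              4 * (C * (2 / l) ^ k) * (1 - c) := by ring
        _ = 4 * (C * (4 * R) ^ k) * (2 * R * l) + 4 * (C * (2 / l) ^ k) * (1 - c) := by
            rw [e1]; ring
        _ ≤ 1 / 2 := by linarith
    calc wnorm (divWeight l c) (shiftA k (U * Z))
        ≤ ENNReal.ofReal ((2 / l) ^ k) * (ENNReal.ofReal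
            (4 * (C * ((2 * R * l) ^ (k + 1) + (1 - c)))) * wnorm (divWeight l c) Z) :=
          h1.trans (by gcongr; exact h2.trans (by gcongr))
      _ ≤ 2⁻¹ * wnorm (divWeight l c) Z := by
          rw [← mul_assoc, ← ENNReal.ofReal_mul (by positivity)]
          gcongr
          refine (ENNReal.ofReal_le_ofReal h4).trans (le_of_eq ?_)
          rw [one_div, ENNReal.ofReal_inv_of_pos (by norm_num)]
          norm_num
  have hY' : wnorm (divWeight l c) (shiftA k (e • Y)) ≠ ⊤ :=
    ne_top_of_le_ne_top (ENNReal.mul_ne_top ENNReal.ofReal_ne_top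
      (wnorm_divWeight_ne_top hl (by linarith) hc1 hC₂ (by linarith) (by linarith) hYb))
      (wnorm_shiftA_le (divWeight_le_shift hl hc0 hc1 k) (e • Y))
  have hw : ∀ p n, divWeight l c p n ≠ 0 := fun p n => by
    have := betaWeight_pos (by linarith) hc1 p n (c := c)
    rw [divWeight, Ne, ENNReal.ofReal_eq_zero, not_le]
    positivity
  -- The equation is `Q = shiftA k (e • Y) + shiftA k (U * Q)`. Since `shiftA k (a^k * Q) = Q`, it
  -- says that `shiftA k` kills `e • (Y - X * Q)`.
  obtain ⟨Q, hQ, hQn⟩ := exists_eq_add_map hw ((shiftA k).comp (AddMonoidHom.mulLeft U)) hcontr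
    (fun S Z h p n => h.mul_left U (p + k) n) hY'
  refine ⟨Q, isConv_of_wnorm_ne_top hl (by nlinarith) hc0 hc1 hQn, fun p n hp => ?_⟩
  obtain ⟨p, rfl⟩ := Nat.exists_eq_add_of_le' hp
  have h1 := congrArg (fun Z : FormalAB => Z.coeff p n) hQ
  simp only [coeff_add, AddMonoidHom.comp_apply, AddMonoidHom.coe_mulLeft, coeff_shiftA,
    coeff_smul] at h1
  rw [hU, add_mul, coeff_add, coeff_mono_mul, if_pos (by omega), Nat.add_sub_cancel,
    Algebra.smul_mul_assoc, coeff_smul] at h1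
  rw [coeff_sub]
  have h2 : e * (Y.coeff (p + k) n - (X * Q).coeff (p + k) n) = 0 := by linear_combination -h1
  exact (mul_eq_zero.1 h2).resolve_left he0

/-! ### Divisibility by `b` -/

/-- Right division by `b`, forgetting the remainder. -/
def shiftB (X : FormalAB) : FormalAB := ⟨fun p n => X.coeff p (n + 1)⟩

theorem coeff_mul_b (X : FormalAB) (m n : ℕ) :
    (X * b).coeff m n = if n = 0 then 0 else X.coeff m (n - 1) := by
  rw [coeff_mul, sum_eq_single (m, 0)]
  · rcases n with _ | n
    · simp [b, mono]
    rw [sum_eq_single (n, 1)]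
    · rw [sum_eq_single (n, 0)]
      · simp [b, mono, Gam_zero_right]
      · rintro ⟨q, j⟩ h1 h2
        have h1 := HasAntidiagonal.mem_antidiagonal.1 h1
        have h3 : j ≠ 0 := by
          rintro rfl
          exact h2 (Prod.ext (by simp only at *; omega) rfl)
        simp [b, mono, h3]
      · simp
    · rintro ⟨t, q'⟩ h1 h2
      have h1 := HasAntidiagonal.mem_antidiagonal.1 h1
      have h3 : q' ≠ 1 := by
        rintro rfl
        exact h2 (Prod.ext (by simp only at *; omega) rfl)
      simp [b, mono, h3]
    · simp
  · rintro ⟨i, j⟩ h1 h2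
    have h1 := HasAntidiagonal.mem_antidiagonal.1 h1
    have h3 : j ≠ 0 := by
      rintro rfl
      exact h2 (Prod.ext (by simp only at *; omega) rfl)
    simp [b, mono, h3]
  · simp

theorem shiftB_mul_b {X : FormalAB} (h : ∀ p, X.coeff p 0 = 0) : shiftB X * b = X := by
  ext p n
  rw [coeff_mul_b]
  rcases n with _ | n
  · rw [if_pos rfl, h]
  · rfl

theorem coeff_b_mul_zero_right (X : FormalAB) (p : ℕ) : (b * X).coeff p 0 = 0 := by
  rw [coeff_mul]
  exact sum_eq_zero fun u _ => by simp [b, mono]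

theorem IsConv.shiftB {X : FormalAB} (hX : IsConv X) : IsConv (shiftB X) := by
  obtain ⟨R, hR, C, h⟩ := hX
  have hC : 0 ≤ C := by simpa using (norm_nonneg _).trans (h 0 0)
  refine ⟨2 * R, by linarith, C * R, fun p n => (h p (n + 1)).trans ?_⟩
  have hfac : ((n + 1).factorial : ℝ) ≤ 2 ^ (p + n) * n.factorial := by
    rw [Nat.factorial_succ]
    have : n + 1 ≤ 2 ^ n := Nat.lt_two_pow_self
    have h2 : (2 : ℕ) ^ n ≤ 2 ^ (p + n) := Nat.pow_le_pow_right (by norm_num) (by omega)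
    exact_mod_cast Nat.mul_le_mul_right _ (this.trans h2)
  calc C * R ^ (p + (n + 1)) * (n + 1).factorial
      ≤ C * R ^ (p + (n + 1)) * (2 ^ (p + n) * n.factorial) := by gcongr
    _ = C * R * (2 * R) ^ (p + n) * n.factorial := by rw [mul_pow]; ring

end FormalAB

/-! ### Order modulo `b` and the division algorithm in the convergent algebra. -/

namespace AConv

open FormalAB

/-- The series `x` has order `k` modulo `b`. -/
def Ord (x : AConv) (k : ℕ) : Prop := x.1.coeff k 0 ≠ 0 ∧ ∀ p < k, x.1.coeff p 0 = 0

theorem exists_ord_or (x : AConv) : (∃ k, Ord x k) ∨ ∃ x', x = x' * b := by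
  classical
  by_cases h : ∃ k, x.1.coeff k 0 ≠ 0
  · exact Or.inl ⟨Nat.find h, Nat.find_spec h, fun p hp => not_not.1 (Nat.find_min h hp)⟩
  · push Not at h
    exact Or.inr ⟨⟨FormalAB.shiftB x.1, x.2.shiftB⟩, Subtype.ext (shiftB_mul_b h).symm⟩

/-- The antiautomorphism which fixes `a` and sends `b` to `-b`. -/
noncomputable def flip (x : AConv) : AConv := ⟨FormalAB.flip x.1, IsConv.flip x.2⟩

theorem flip_flip (x : AConv) : flip (flip x) = x := Subtype.ext (FormalAB.flip_flip x.1)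
theorem flip_mul (x y : AConv) : flip (x * y) = flip y * flip x :=
  Subtype.ext (FormalAB.flip_mul x.1 y.1)
theorem flip_add (x y : AConv) : flip (x + y) = flip x + flip y :=
  Subtype.ext (FormalAB.flip_add x.1 y.1)
theorem flip_b : flip b = -b := Subtype.ext FormalAB.flip_b

theorem Ord.flip {x : AConv} {k : ℕ} (h : Ord x k) : Ord (flip x) k := by
  simpa [Ord, AConv.flip, coeff_flip_zero_right] using h

theorem Ord.neg {x : AConv} {k : ℕ} (h : Ord x k) : Ord (-x) k := by
  simpa [Ord] using h

/-- Reordering `b * s` never lowers the exponent of `b`, so no pure power of `a` survives and a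
right factor `b` splits off. With `exists_mul_b_eq` this supplies the semilinearity of
multiplication by `b`. -/
theorem exists_b_mul_eq (s : AConv) : ∃ s', b * s = s' * b :=
  ⟨⟨FormalAB.shiftB (b * s).1, (b * s).2.shiftB⟩,
    Subtype.ext (shiftB_mul_b (coeff_b_mul_zero_right s.1)).symm⟩

theorem exists_mul_b_eq (s : AConv) : ∃ s', s * b = b * s' := by
  obtain ⟨t, ht⟩ := exists_b_mul_eq (flip s)
  refine ⟨flip t, ?_⟩
  have h := congrArg flip ht
  rwa [flip_mul, flip_mul, flip_flip, flip_b, mul_neg, neg_mul, neg_inj] at h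

/-- Right factors `b` are removed until an order exists; a nonzero coefficient at `b^n` allows at
most `n` removals. The last conjunct records that the leading coefficient of `r` is the coefficient
of `a^k b^m` in `x`, which later locates the order of a remainder. -/
theorem exists_eq_iterate (x : AConv) (hx : x ≠ 0) : ∃ m r k,
    x = (AddMonoidHom.mulRight b)^[m] r ∧ Ord r k ∧ x.1.coeff k m ≠ 0 := by
  have hmain : ∀ n, ∀ x : AConv, (∃ p, x.1.coeff p n ≠ 0) → ∃ m r k,
      x = (AddMonoidHom.mulRight b)^[m] r ∧ Ord r k ∧ x.1.coeff k m ≠ 0 := by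
    intro n
    induction n with
    | zero =>
      rintro x ⟨p, hp⟩
      obtain ⟨k, hk⟩ | ⟨x', rfl⟩ := exists_ord_or x
      · exact ⟨0, x, k, rfl, hk, hk.1⟩
      · exact absurd ((coeff_mul_b x'.1 p 0).trans (if_pos rfl)) hp
    | succ n ih =>
      rintro x ⟨p, hp⟩
      obtain ⟨k, hk⟩ | ⟨x', rfl⟩ := exists_ord_or x
      · exact ⟨0, x, k, rfl, hk, hk.1⟩
      · obtain ⟨m, r, k, h1, h2, h3⟩ := ih x' ⟨p, fun h => hp ((coeff_mul_b x'.1 p (n + 1)).trans h)⟩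
        refine ⟨m + 1, r, k, ?_, h2, fun h => h3 ((coeff_mul_b x'.1 k (m + 1)).symm.trans h)⟩
        rw [Function.iterate_succ_apply', ← h1]
        rfl
  by_contra hcon
  refine hx (Subtype.ext (FormalAB.ext ?_))
  funext p n
  by_contra hp
  exact hcon (hmain n x ⟨p, hp⟩)

theorem exists_division (x y : AConv) {k : ℕ} (hx : Ord x k) : ∃ s : AConv, y = x * s ∨
    ∃ m r l, y - x * s = (AddMonoidHom.mulRight b)^[m] r ∧ Ord r l ∧ l < k := by
  obtain ⟨Q, hQ, hr⟩ := FormalAB.exists_division x.2 y.2 hx.1 hx.2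
  refine ⟨⟨Q, hQ⟩, ?_⟩
  by_cases h : y - x * ⟨Q, hQ⟩ = 0
  · exact Or.inl (sub_eq_zero.1 h)
  · obtain ⟨m, r, l, h1, h2, h3⟩ := exists_eq_iterate _ h
    -- The remainder has a nonzero coefficient at `a^l b^m`, while all those with `l ≥ k` vanish.
    exact Or.inr ⟨m, r, l, h1, h2, not_le.1 fun hl => h3 (hr l m hl)⟩

/-- The witness is `(-1)^m` times `flip r`; the sign does not affect orders. -/
theorem exists_flip_iterate (m : ℕ) (r : AConv) : ∃ r',
    flip ((AddMonoidHom.mulRight b)^[m] r) = (AddMonoidHom.mulLeft b)^[m] r' ∧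
      ∀ l, Ord r l → Ord r' l := by
  induction m with
  | zero => exact ⟨flip r, rfl, fun l h => h.flip⟩
  | succ m ih =>
    obtain ⟨r', h1, h2⟩ := ih
    refine ⟨-r', ?_, fun l h => (h2 l h).neg⟩
    rw [Function.iterate_succ_apply', Function.iterate_succ_apply', iterate_map_neg, ← h1,
      AddMonoidHom.mulRight_apply, AddMonoidHom.coe_mulLeft, flip_mul, flip_b, neg_mul, mul_neg]

/-! ### Division structures for right and left ideals. -/

theorem hasDivision_right :
    HasDivision (AConv)ᵐᵒᵖ (AddMonoidHom.mulRight b : AConv →+ AConv) Ord where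
  semilinear s := by
    obtain ⟨t, ht⟩ := exists_mul_b_eq s.unop
    refine ⟨MulOpposite.op t, fun x => ?_⟩
    change x * s.unop * b = x * b * t
    rw [mul_assoc, ht, mul_assoc]
  exists_ord := exists_ord_or
  division x y k hx := by
    obtain ⟨s, hs⟩ := exists_division x y hx
    exact ⟨MulOpposite.op s, hs⟩

theorem hasDivision_left :
    HasDivision AConv (AddMonoidHom.mulLeft b : AConv →+ AConv) Ord where
  semilinear s := by
    obtain ⟨t, ht⟩ := exists_b_mul_eq s
    refine ⟨t, fun x => ?_⟩
    change b * (s * x) = t * (b * x)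
    rw [← mul_assoc, ht, mul_assoc]
  exists_ord x := by
    refine (exists_ord_or (flip x)).imp (fun ⟨k, hk⟩ => ⟨k, flip_flip x ▸ hk.flip⟩) ?_
    rintro ⟨x', hx'⟩
    refine ⟨-flip x', ?_⟩
    rw [← flip_flip x, hx', flip_mul, flip_b, AddMonoidHom.coe_mulLeft, neg_mul, mul_neg]
  division x y k hx := by
    obtain ⟨s, hs⟩ := exists_division (flip x) (flip y) hx.flip
    refine ⟨flip s, hs.imp (fun h => ?_) ?_⟩
    · have h := congrArg flip h
      rwa [flip_mul, flip_flip, flip_flip] at h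
    · rintro ⟨m, r, l, h1, h2, h3⟩
      obtain ⟨r', h4, h5⟩ := exists_flip_iterate m r
      refine ⟨m, r', l, ?_, h5 l h2, h3⟩
      have h := congrArg flip (sub_eq_iff_eq_add.1 h1)
      rw [flip_add, flip_mul, flip_flip, flip_flip, h4] at h
      exact sub_eq_iff_eq_add.2 h

theorem exists_eq_iterate_right (x : AConv) (hx : x ≠ 0) : ∃ m r k,
    x = (AddMonoidHom.mulRight b)^[m] r ∧ Ord r k := by
  obtain ⟨m, r, k, h1, h2, -⟩ := exists_eq_iterate x hx
  exact ⟨m, r, k, h1, h2⟩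

theorem exists_eq_iterate_left (x : AConv) (hx : x ≠ 0) : ∃ m r k,
    x = (AddMonoidHom.mulLeft b)^[m] r ∧ Ord r k := by
  have hx' : flip x ≠ 0 := fun h => hx (by
    have h0 : flip 0 = 0 := by simpa using flip_add 0 0
    rw [← flip_flip x, h, h0])
  obtain ⟨m, r, k, h1, h2, -⟩ := exists_eq_iterate _ hx'
  obtain ⟨r', h3, h4⟩ := exists_flip_iterate m r
  exact ⟨m, r', k, by rw [← h3, ← h1, flip_flip], h4 k h2⟩

end AConv

theorem mainTheorem3 :
    IsNoetherian AConv AConv ∧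
    IsNoetherian (AConv)ᵐᵒᵖ AConv ∧
    (∀ I : Submodule AConv AConv, AConv.IsNormalLeft I → ∃ x : AConv, I = Submodule.span AConv {x}) ∧
    (∀ I : Submodule (AConv)ᵐᵒᵖ AConv, AConv.IsNormalRight I →
      ∃ x : AConv, I = Submodule.span (AConv)ᵐᵒᵖ {x}) :=
  ⟨AConv.hasDivision_left.isNoetherian AConv.exists_eq_iterate_left
      fun I _ hx => I.smul_mem AConv.b hx,
    AConv.hasDivision_right.isNoetherian AConv.exists_eq_iterate_right
      fun I _ hx => I.smul_mem (MulOpposite.op AConv.b) hx,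
    fun I hI => AConv.hasDivision_left.exists_eq_span_singleton AConv.exists_eq_iterate_left I hI,
    fun I hI => AConv.hasDivision_right.exists_eq_span_singleton AConv.exists_eq_iterate_right I hI⟩
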